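/- Let $k\ge 0$ be an integer, let $\|\cdot\|$ be the Euclidean norm on $\mathbb{C}^k$, and let $\mathbf{B}$ be the unit ball. Let $F_1, F_2, \ldots$ be holomorphic automorphisms of $\mathbb{C}^k$ with $F_n(0)=0$ for all $n$, and write $F(n) = F_n\circ\cdots\circ F_1$. Suppose that every $F_n'(0)$ is lower triangular, with diagonal entries $\lambda_{n,1},\ldots,\lambda_{n,k}$ (from upper left to lower right), and that the sequence is correctly ordered and uniformly attracting, that is: (i) for every $n$, $|\lambda_{n,j}||\lambda_{n,i}| < |\lambda_{n,l}|$ for all $l\le j$ and all $i$; (ii) there are real numbers $0<a<b<1$ such that $a\|z\|\le\|F_n(z)\|\le b\|z\|$ for all $n$ and all $z\in\mathbf{B}$; (iii) there is a real number $\xi<1$ such that $|\lambda_{n,i}||\lambda_{n,j}|\le\xi|\lambda_{n,l}|$ for all $n$, all $l\le j$ and all $i$. Then the basin of attraction $$\Omega=\{z\in\mathbb{C}^k : F(n)(z)\to 0 \text{ as } n\to\infty\}$$ is open and biholomorphic to $\mathbb{C}^k$. More precisely, there are - polynomial automorphisms $G_1,G_2,\ldots$ of $\mathbb{C}^k$ with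 $G_n(0)=0$ and $G_n'(0)=F_n'(0)$ that are lower triangular, i.e. the $j$-th component of $G_n$ has the form $c_jz_j+h_j(z_1,\ldots,z_{j-1})$ with a constant $c_j$ and a polynomial $h_j$ (both depending on $n$), and whose degrees and coefficients are bounded uniformly in $n$; and - polynomial maps $X_0,X_1,X_2,\ldots:\mathbb{C}^k\to\mathbb{C}^k$ with $X_n(0)=0$ and $X_n'(0)=\mathrm{id}$, whose degrees and coefficients are bounded uniformly in $n$, such that, with $G(n)=G_n\circ\cdots\circ G_1$, the maps $G(n)^{-1}\circ X_n\circ F(n)$ converge, uniformly on compact subsets of $\Omega$, to a biholomorphic map $\Psi$ from $\Omega$ onto $\mathbb{C}^k$. -/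

import Mathlib

open Filter Topology

noncomputable section

/-- Complex Euclidean space `ℂ^k` with its Euclidean norm. -/
abbrev CSpace (k : ℕ) : Type := EuclideanSpace ℂ (Fin k)

/-- `Aut₀(ℂ^k)`: the holomorphic automorphisms of `ℂ^k` that fix the origin. -/
structure Aut0 (k : ℕ) extends CSpace k ≃ CSpace k where
  differentiable_toFun : Differentiable ℂ toFun
  differentiable_invFun : Differentiable ℂ invFun
  map_zero' : toFun 0 = 0

/-- The Jacobian matrix of `f` at the origin, `(i, j) ↦ ∂f_i/∂z_j (0)`. -/
def jacobianZero {k : ℕ} (f : CSpace k → CSpace k) : Matrix (Fin k) (Fin k) ℂ :=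
  Matrix.of fun i j => (fderiv ℂ f 0 (EuclideanSpace.single j 1)) i

namespace Aut0

/-- The diagonal entries `λ_1, …, λ_k` of `F'(0)`. -/
def diagEntry {k : ℕ} (F : Aut0 k) (i : Fin k) : ℂ := jacobianZero F.toFun i i

/-- `F'(0)` is lower triangular. -/
def InLowerTriangularForm {k : ℕ} (F : Aut0 k) : Prop :=
  ∀ i j : Fin k, i < j → jacobianZero F.toFun i j = 0

/-- `F` is in lower triangular form and `|λ_j| |λ_i| < |λ_l|` for all `l ≤ j` and all `i`. -/
def CorrectlyOrdered {k : ℕ} (F : Aut0 k) : Prop :=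
  F.InLowerTriangularForm ∧
    ∀ i j l : Fin k, l ≤ j → ‖F.diagEntry j‖ * ‖F.diagEntry i‖ < ‖F.diagEntry l‖

/-- Uniform attraction of a family of (correctly ordered) automorphisms. -/
def UniformlyAttracting {k : ℕ} (𝓕 : Set (Aut0 k)) : Prop :=
  (∃ a b : ℝ, 0 < a ∧ a < b ∧ b < 1 ∧
    ∀ F ∈ 𝓕, ∀ z ∈ Metric.ball (0 : CSpace k) 1,
      a * ‖z‖ ≤ ‖F.toFun z‖ ∧ ‖F.toFun z‖ ≤ b * ‖z‖) ∧
  ∃ ξ : ℝ, ξ < 1 ∧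
    ∀ F ∈ 𝓕, ∀ i j l : Fin k, l ≤ j →
      ‖F.diagEntry i‖ * ‖F.diagEntry j‖ ≤ ξ * ‖F.diagEntry l‖

/-- The composition of the first `n` maps of a sequence. The sequence `F_1, F_2, …` is indexed
from `0`, that is, `F n` stands for `F_{n+1}`, so that `compFirst F n = F_n ∘ ⋯ ∘ F_1`. -/
def compFirst {k : ℕ} (F : ℕ → Aut0 k) : ℕ → (CSpace k ≃ CSpace k)
  | 0 => Equiv.refl _
  | n + 1 => (compFirst F n).trans (F n).toEquiv

/-- The basin of attraction of a sequence of automorphisms that fix the origin. -/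
def basin {k : ℕ} (F : ℕ → Aut0 k) : Set (CSpace k) :=
  {z | Tendsto (fun n => compFirst F n z) atTop (𝓝 0)}

end Aut0

/-- `f` maps the open set `U` biholomorphically onto the open set `V`. -/
def IsBiholomorphicOnto {k : ℕ} (f : CSpace k → CSpace k) (U V : Set (CSpace k)) : Prop :=
  IsOpen U ∧ IsOpen V ∧ DifferentiableOn ℂ f U ∧ Set.MapsTo f U V ∧
    ∃ g : CSpace k → CSpace k,
      DifferentiableOn ℂ g V ∧ Set.MapsTo g V U ∧ Set.InvOn g f U V

/-- The components of a polynomial self-map of `ℂ^k`. -/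
abbrev PolyMap (k : ℕ) : Type := Fin k → MvPolynomial (Fin k) ℂ

namespace PolyMap

/-- The self-map of `ℂ^k` given by `k` polynomials. -/
def toMap {k : ℕ} (P : PolyMap k) (z : CSpace k) : CSpace k :=
  WithLp.toLp 2 fun j => MvPolynomial.eval (fun i => z i) (P j)

/-- `P(0) = 0` and `P_j(z) = c_j z_j + h_j(z_1, …, z_{j-1})` for every `j`. -/
def IsLowerTriangular {k : ℕ} (P : PolyMap k) : Prop :=
  P.toMap 0 = 0 ∧
    ∀ j : Fin k, ∃ (c : ℂ) (h : MvPolynomial (Fin k) ℂ),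
      h ∈ MvPolynomial.supported ℂ (Set.Iio j) ∧
        P j = MvPolynomial.C c * MvPolynomial.X j + h

/-- A sequence of polynomial maps is bounded: degrees and coefficients are uniformly bounded. -/
def BoundedSeq {k : ℕ} (P : ℕ → PolyMap k) : Prop :=
  ∃ (d : ℕ) (M : ℝ), ∀ (n : ℕ) (j : Fin k),
    (P n j).totalDegree ≤ d ∧ ∀ α : Fin k →₀ ℕ, ‖MvPolynomial.coeff α (P n j)‖ ≤ M

end PolyMap

end

open Metric

/-! ### Cauchy estimates and regularity of holomorphic maps between normed spaces -/

section HolomorphicMaps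

variable {E F : Type*} [NormedAddCommGroup E] [NormedSpace ℂ E]
  [NormedAddCommGroup F] [NormedSpace ℂ F]

/-- Cauchy's estimate for the Fréchet derivative. -/
theorem norm_fderiv_le_of_norm_le_on_ball {f : E → F} {c : E} {R M : ℝ} (hR : 0 < R)
    (hd : DifferentiableOn ℂ f (ball c R)) (hM : ∀ z ∈ ball c R, ‖f z‖ ≤ M) :
    ‖fderiv ℂ f c‖ ≤ 2 * M / R := by
  refine Complex.norm_fderiv_le_div_of_mapsTo_ball hd (fun z hz => ?_) hR
  rw [mem_closedBall, dist_eq_norm]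
  calc ‖f z - f c‖ ≤ ‖f z‖ + ‖f c‖ := norm_sub_le _ _
    _ ≤ 2 * M := by linarith [hM z hz, hM c (mem_ball_self hR)]

theorem norm_fderiv_le_of_norm_le_on_larger_ball {f : E → F} {c x : E} {r R M : ℝ} (hrR : r < R)
    (hd : DifferentiableOn ℂ f (ball c R)) (hM : ∀ z ∈ ball c R, ‖f z‖ ≤ M)
    (hx : x ∈ closedBall c r) : ‖fderiv ℂ f x‖ ≤ 2 * M / (R - r) := by
  have hsub : ball x (R - r) ⊆ ball c R := by
    apply ball_subset_ball'
    have := mem_closedBall.1 hx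
    linarith
  exact norm_fderiv_le_of_norm_le_on_ball (sub_pos.2 hrR) (hd.mono hsub) fun z hz => hM z (hsub hz)

theorem norm_sub_le_of_norm_le_on_larger_ball {f : E → F} {c x y : E} {r R M : ℝ} (hrR : r < R)
    (hd : DifferentiableOn ℂ f (ball c R)) (hM : ∀ z ∈ ball c R, ‖f z‖ ≤ M)
    (hx : x ∈ closedBall c r) (hy : y ∈ closedBall c r) :
    ‖f y - f x‖ ≤ 2 * M / (R - r) * ‖y - x‖ := by
  let _ : NormedSpace ℝ E := NormedSpace.restrictScalars ℝ ℂ E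
  refine (convex_closedBall c r).norm_image_sub_le_of_norm_fderiv_le (𝕜 := ℂ) (fun z hz => ?_)
    (fun z hz => norm_fderiv_le_of_norm_le_on_larger_ball hrR hd hM hz) hx hy
  exact hd.differentiableAt (isOpen_ball.mem_nhds (closedBall_subset_ball hrR hz))

/-- The derivative of a bounded holomorphic map is Lipschitz on a smaller ball. -/
theorem norm_fderiv_sub_le_of_norm_le_on_larger_ball {f : E → F} {c x y : E} {r R M : ℝ}
    (hr : 0 ≤ r) (hrR : r < R)
    (hd : DifferentiableOn ℂ f (ball c R)) (hM : ∀ z ∈ ball c R, ‖f z‖ ≤ M)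
    (hx : x ∈ closedBall c r) (hy : y ∈ closedBall c r) :
    ‖fderiv ℂ f y - fderiv ℂ f x‖ ≤ 48 * M / (R - r) ^ 2 * ‖y - x‖ := by
  set ρ := (R - r) / 3 with hρ
  have hρ0 : 0 < ρ := by rw [hρ]; linarith
  have hM0 : 0 ≤ M := (norm_nonneg _).trans (hM c (mem_ball_self (by linarith)))
  have hxn := mem_closedBall.1 hx
  have hyn := mem_closedBall.1 hy
  -- For distant points the bound on each derivative suffices. For close points Cauchy's estimate is
  -- applied to `z ↦ f (z + (y - x)) - f z`, which is already `O(‖y - x‖)` near `x`.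
  rcases le_or_gt ρ ‖y - x‖ with h | h
  · have h1 := norm_fderiv_le_of_norm_le_on_larger_ball hrR hd hM hx
    have h2 := norm_fderiv_le_of_norm_le_on_larger_ball hrR hd hM hy
    have hpos : 0 < R - r := by linarith
    calc ‖fderiv ℂ f y - fderiv ℂ f x‖ ≤ ‖fderiv ℂ f y‖ + ‖fderiv ℂ f x‖ := norm_sub_le _ _
      _ ≤ 4 * M / (R - r) := by
        have : 4 * M / (R - r) = 2 * M / (R - r) + 2 * M / (R - r) := by ring
        linarith
      _ ≤ 48 * M / (R - r) ^ 2 * ρ := by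
        rw [hρ, div_mul_div_comm, div_le_div_iff₀ hpos (by positivity)]
        nlinarith [mul_nonneg hM0 (sq_nonneg (R - r))]
      _ ≤ _ := by gcongr
  · have hsub : ball x ρ ⊆ closedBall c (r + ρ) := fun z hz => by
      have := mem_ball.1 hz
      rw [mem_closedBall]
      linarith [dist_triangle z x c]
    have hsub1 : ball x ρ ⊆ ball c R := hsub.trans (closedBall_subset_ball (by rw [hρ]; linarith))
    have hsub2 : ∀ z ∈ ball x ρ, z + (y - x) ∈ closedBall c (r + 2 * ρ) := fun z hz => by
      have h1 := mem_closedBall.1 (hsub hz)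
      rw [mem_closedBall, dist_eq_norm] at *
      calc ‖z + (y - x) - c‖ = ‖(z - c) + (y - x)‖ := by congr 1; abel
        _ ≤ ‖z - c‖ + ‖y - x‖ := norm_add_le _ _
        _ ≤ _ := by linarith
    have hlt : r + 2 * ρ < R := by rw [hρ]; linarith
    have hda : ∀ z ∈ ball x ρ, DifferentiableAt ℂ (fun z => f (z + (y - x))) z := fun z hz => by
      have : DifferentiableAt ℂ f (z + (y - x)) :=
        hd.differentiableAt (isOpen_ball.mem_nhds (closedBall_subset_ball hlt (hsub2 z hz)))
      exact this.comp z (by fun_prop)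
    have hdb : ∀ z ∈ ball x ρ, DifferentiableAt ℂ f z := fun z hz =>
      hd.differentiableAt (isOpen_ball.mem_nhds (hsub1 hz))
    have key := norm_fderiv_le_of_norm_le_on_ball (f := fun z => f (z + (y - x)) - f z) (c := x)
      (R := ρ) (M := 2 * M / (R - (r + 2 * ρ)) * ‖y - x‖) hρ0
      (fun z hz => ((hda z hz).sub (hdb z hz)).differentiableWithinAt)
      (fun z hz => by
        have := norm_sub_le_of_norm_le_on_larger_ball hlt hd hM
          (closedBall_subset_closedBall (by linarith) (hsub hz)) (hsub2 z hz)
        simpa using this)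
    have hx0 := mem_ball_self (x := x) hρ0
    rw [fderiv_fun_sub (hda x hx0) (hdb x hx0), fderiv_comp_add_right] at key
    rw [show x + (y - x) = y by abel] at key
    refine key.trans ?_
    have hRr : R - (r + 2 * ρ) = ρ := by rw [hρ]; ring
    have hR3 : R - r = 3 * ρ := by rw [hρ]; ring
    rw [hRr, hR3]
    have : 2 * (2 * M / ρ * ‖y - x‖) / ρ = 4 * M / ρ ^ 2 * ‖y - x‖ := by field_simp; ring
    rw [this]
    have h3 : 48 * M / (3 * ρ) ^ 2 = 48 / 9 * M / ρ ^ 2 := by field_simp; ring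
    rw [h3]
    gcongr
    norm_num

/-- First order Taylor estimate for bounded holomorphic maps. -/
theorem norm_sub_sub_fderiv_le_of_norm_le_on_larger_ball {f : E → F} {x y : E} {r R M : ℝ}
    (hrR : r < R) (hd : DifferentiableOn ℂ f (ball 0 R)) (hM : ∀ z ∈ ball 0 R, ‖f z‖ ≤ M)
    (hx : ‖x‖ ≤ r) (hy : ‖y‖ ≤ r) :
    ‖f y - f x - fderiv ℂ f 0 (y - x)‖ ≤
      48 * M / (R - r) ^ 2 * max ‖x‖ ‖y‖ * ‖y - x‖ := by
  let _ : NormedSpace ℝ E := NormedSpace.restrictScalars ℝ ℂ E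
  have hr : 0 ≤ r := (norm_nonneg _).trans hx
  have hM0 : 0 ≤ M := (norm_nonneg _).trans (hM 0 (mem_ball_self (by linarith)))
  have hm : max ‖x‖ ‖y‖ ≤ r := max_le hx hy
  refine (convex_closedBall (0 : E) (max ‖x‖ ‖y‖)).norm_image_sub_le_of_norm_fderiv_le' (𝕜 := ℂ)
    (fun z hz => ?_) (fun z hz => ?_) (by simp) (by simp)
  · exact hd.differentiableAt (isOpen_ball.mem_nhds
      (closedBall_subset_ball (lt_of_le_of_lt hm hrR) hz))
  · have h := norm_fderiv_sub_le_of_norm_le_on_larger_ball hr hrR hd hM (x := 0) (y := z)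
      (by simpa using hr) (closedBall_subset_closedBall hm hz)
    refine h.trans ?_
    have hz' : ‖z‖ ≤ max ‖x‖ ‖y‖ := by simpa using hz
    rw [sub_zero]
    gcongr

/-- Weierstrass' theorem: uniform limits of holomorphic maps are holomorphic. -/
theorem differentiableOn_ball_of_tendstoUniformlyOn [CompleteSpace F] {f : ℕ → E → F} {g : E → F}
    {c : E} {R : ℝ} (hd : ∀ n, DifferentiableOn ℂ (f n) (ball c R))
    (hfg : TendstoUniformlyOn f g atTop (ball c R)) : DifferentiableOn ℂ g (ball c R) := by
  intro x hx
  set ρ := (R - dist x c) / 2 with hρ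
  have hρ0 : 0 < ρ := by have := mem_ball.1 hx; rw [hρ]; linarith
  have hsub : ball x (2 * ρ) ⊆ ball c R := ball_subset_ball' (by rw [hρ]; linarith)
  -- Cauchy's estimate on differences makes the derivatives uniformly Cauchy, so the real-variable
  -- theorem on differentiating a limit applies.
  have hC : UniformCauchySeqOn (fun n => fderiv ℂ (f n)) atTop (ball x ρ) := by
    have h1 := hfg.uniformCauchySeqOn
    rw [Metric.uniformCauchySeqOn_iff] at h1 ⊢
    intro ε hε
    obtain ⟨N, hN⟩ := h1 (ε * ρ / 4) (by positivity)
    refine ⟨N, fun m hm n hn y hy => ?_⟩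
    have hda : ∀ k, ∀ z ∈ ball c R, DifferentiableAt ℂ (f k) z := fun k z hz =>
      (hd k).differentiableAt (isOpen_ball.mem_nhds hz)
    have h2 := norm_fderiv_le_of_norm_le_on_larger_ball (f := fun z => f m z - f n z) (c := x)
      (x := y) (r := ρ) (R := 2 * ρ) (M := ε * ρ / 4) (by linarith)
      (((hd m).sub (hd n)).mono hsub)
      (fun z hz => by rw [← dist_eq_norm]; exact (hN m hm n hn z (hsub hz)).le)
      (ball_subset_closedBall hy)
    have hy' := hsub (ball_subset_ball (by linarith) hy)
    rw [fderiv_fun_sub (hda m y hy') (hda n y hy')] at h2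
    rw [dist_eq_norm]
    refine h2.trans_lt ?_
    have : 2 * (ε * ρ / 4) / (2 * ρ - ρ) = ε / 2 := by
      rw [show 2 * ρ - ρ = ρ by ring]; field_simp; ring
    rw [this]; linarith
  have hlim : ∀ y ∈ ball x ρ, ∃ l, Tendsto (fun n => fderiv ℂ (f n) y) atTop (𝓝 l) := fun y hy =>
    cauchySeq_tendsto_of_complete (hC.cauchySeq hy)
  choose! g' hg' using hlim
  have hu : TendstoUniformlyOn (fun n => fderiv ℂ (f n)) g' atTop (ball x ρ) :=
    hC.tendstoUniformlyOn_of_tendsto hg'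
  have hss : ball x ρ ⊆ ball c R := (ball_subset_ball (by linarith)).trans hsub
  exact (hasFDerivAt_of_tendstoUniformlyOn isOpen_ball hu
    (fun n y hy => ((hd n).differentiableAt (isOpen_ball.mem_nhds (hss hy))).hasFDerivAt)
    (fun y hy => hfg.tendsto_at (hss hy)) (mem_ball_self hρ0)).differentiableAt.differentiableWithinAt

/-- A directional derivative is a locally uniform limit of difference quotients, which are
themselves entire, so Weierstrass' theorem applies. -/
theorem Differentiable.fderiv_apply_const_of_complex [CompleteSpace F] {f : E → F}
    (hf : Differentiable ℂ f) (v : E) : Differentiable ℂ fun z => fderiv ℂ f z v := by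
  intro c
  obtain ⟨R, hR, hM⟩ : ∃ R > 0, ∀ z ∈ ball c R, ‖f z‖ ≤ ‖f c‖ + 1 := by
    have h := hf.continuous.continuousAt (x := c)
    obtain ⟨R, hR, h⟩ := Metric.continuousAt_iff.1 h 1 one_pos
    refine ⟨R, hR, fun z hz => ?_⟩
    have h1 := h hz
    rw [dist_eq_norm] at h1
    linarith [norm_le_norm_add_norm_sub (f c) (f z), norm_sub_rev (f z) (f c)]
  set M := ‖f c‖ + 1
  have hM0 : 0 ≤ M := by positivity
  set K := 48 * M / (R - R / 2) ^ 2
  have hK : 0 ≤ K := by positivity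
  -- The difference quotients converge locally uniformly.
  obtain ⟨n₀, hn₀⟩ := exists_nat_gt (4 * ‖v‖ / R)
  let t : ℕ → ℂ := fun n => ((n + n₀ + 1 : ℕ) : ℂ)⁻¹
  have ht0 : ∀ n, t n ≠ 0 := fun n => inv_ne_zero (Nat.cast_ne_zero.2 (by omega))
  have htn : ∀ n, ‖t n‖ = ((n + n₀ + 1 : ℕ) : ℝ)⁻¹ := fun n => by
    simp only [t, norm_inv, Complex.norm_natCast]
  have htv : ∀ n, ‖t n • v‖ ≤ R / 4 := fun n => by
    rw [norm_smul, htn, inv_mul_le_iff₀ (by positivity)]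
    have h1 := (div_lt_iff₀ hR).1 hn₀
    push_cast
    nlinarith [Nat.cast_nonneg (α := ℝ) n, Nat.cast_nonneg (α := ℝ) n₀]
  have hlim : TendstoUniformlyOn (fun n z => (t n)⁻¹ • (f (z + t n • v) - f z))
      (fun z => fderiv ℂ f z v) atTop (ball c (R / 4)) := by
    have h0 : Tendsto (fun n => K * ‖v‖ * ‖v‖ * ‖t n‖) atTop (𝓝 0) := by
      have : Tendsto (fun n : ℕ => ((n + n₀ + 1 : ℕ) : ℝ)⁻¹) atTop (𝓝 0) :=
        tendsto_inv_atTop_zero.comp (tendsto_natCast_atTop_atTop.comp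
          (tendsto_atTop_mono (fun n => (by omega : n ≤ n + n₀ + 1)) tendsto_id))
      simpa [htn] using this.const_mul (K * ‖v‖ * ‖v‖)
    rw [Metric.tendstoUniformlyOn_iff]
    intro ε hε
    filter_upwards [h0.eventually (gt_mem_nhds hε)] with n hn z hz
    refine lt_of_le_of_lt ?_ hn
    rw [dist_eq_norm]
    let _ : NormedSpace ℝ E := NormedSpace.restrictScalars ℝ ℂ E
    have hz' := mem_ball.1 hz
    have hsub : closedBall z ‖t n • v‖ ⊆ closedBall c (R / 2) := fun w hw => by
      have := mem_closedBall.1 hw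
      rw [mem_closedBall]
      linarith [dist_triangle w z c, htv n]
    have key := (convex_closedBall z ‖t n • v‖).norm_image_sub_le_of_norm_fderiv_le' (𝕜 := ℂ)
      (f := f) (φ := fderiv ℂ f z) (C := K * ‖t n • v‖) (x := z) (y := z + t n • v)
      (fun w _ => hf w) (fun w hw => by
        have h1 := norm_fderiv_sub_le_of_norm_le_on_larger_ball (by linarith) (half_lt_self hR)
          hf.differentiableOn hM (hsub (mem_closedBall_self (norm_nonneg _))) (hsub hw)
        refine h1.trans ?_
        have : ‖w - z‖ ≤ ‖t n • v‖ := by rw [← dist_eq_norm]; exact mem_closedBall.1 hw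
        gcongr) (mem_closedBall_self (norm_nonneg _)) (by simp)
    rw [show z + t n • v - z = t n • v by abel, map_smul] at key
    have h2 : fderiv ℂ f z v - (t n)⁻¹ • (f (z + t n • v) - f z) =
        -((t n)⁻¹ • (f (z + t n • v) - f z - t n • fderiv ℂ f z v)) := by
      rw [smul_sub _ _ (t n • _), inv_smul_smul₀ (ht0 n)]; abel
    rw [h2, norm_neg, norm_smul, norm_inv, inv_mul_le_iff₀ (norm_pos_iff.2 (ht0 n))]
    refine key.trans (le_of_eq ?_)
    rw [norm_smul]; ring
  refine (differentiableOn_ball_of_tendstoUniformlyOn (fun n => ?_) hlim).differentiableAt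
    (ball_mem_nhds c (by positivity))
  have : Differentiable ℂ fun z => (t n)⁻¹ • (f (z + t n • v) - f z) :=
    ((hf.comp (by fun_prop : Differentiable ℂ fun z => z + t n • v)).sub hf).const_smul _
  exact this.differentiableOn

theorem differentiable_of_forall_differentiable_apply [FiniteDimensional ℂ E]
    {D : Type*} [NormedAddCommGroup D] [NormedSpace ℂ D]
    {f : D → E →L[ℂ] F} (h : ∀ v, Differentiable ℂ fun x => f x v) : Differentiable ℂ f := by
  let d := Module.finrank ℂ E
  have hd : d = Module.finrank ℂ (Fin d → ℂ) := (Module.finrank_fin_fun ℂ).symm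
  let e₁ := ContinuousLinearEquiv.ofFinrankEq hd
  let e₂ := (e₁.arrowCongr (1 : F ≃L[ℂ] F)).trans (ContinuousLinearEquiv.piRing (Fin d))
  rw [← Function.id_comp f, ← e₂.symm_comp_self]
  exact e₂.symm.differentiable.comp (differentiable_pi.mpr fun i => h _)

/-- Entire maps on a finite-dimensional space are smooth. -/
theorem Differentiable.fderiv_of_complex [FiniteDimensional ℂ E] [CompleteSpace F] {f : E → F}
    (hf : Differentiable ℂ f) : Differentiable ℂ (fderiv ℂ f) :=
  differentiable_of_forall_differentiable_apply hf.fderiv_apply_const_of_complex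

end HolomorphicMaps

/-! ### Higher derivatives and leading Taylor terms -/

theorem Differentiable.contDiff_of_complex {E : Type} [NormedAddCommGroup E] [NormedSpace ℂ E]
    [FiniteDimensional ℂ E] (n : ℕ) {F : Type} [NormedAddCommGroup F] [NormedSpace ℂ F]
    [CompleteSpace F] {f : E → F} (hf : Differentiable ℂ f) : ContDiff ℂ n f := by
  induction n generalizing F with
  | zero => exact contDiff_zero.2 hf.continuous
  | succ n ih =>
    rw [Nat.cast_add, Nat.cast_one, contDiff_succ_iff_fderiv]
    exact ⟨hf, by simp, ih hf.fderiv_of_complex⟩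

/-- Cauchy's estimates for the higher derivatives of an entire map. -/
theorem exists_norm_iteratedFDeriv_le {E : Type} [NormedAddCommGroup E] [NormedSpace ℂ E]
    [FiniteDimensional ℂ E] (m : ℕ) {R : ℝ} (hR : 0 < R) : ∃ K : ℝ, 0 ≤ K ∧
    ∀ {F : Type} [NormedAddCommGroup F] [NormedSpace ℂ F] [CompleteSpace F] (f : E → F) (M : ℝ),
      Differentiable ℂ f → (∀ z ∈ ball 0 R, ‖f z‖ ≤ M) → ‖iteratedFDeriv ℂ m f 0‖ ≤ K * M := by
  induction m generalizing R with
  | zero =>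
    refine ⟨1, zero_le_one, fun f M hf hM => ?_⟩
    rw [norm_iteratedFDeriv_zero, one_mul]
    exact hM 0 (mem_ball_self hR)
  | succ m ih =>
    obtain ⟨K, hK, h⟩ := ih (half_pos hR)
    refine ⟨K * (2 / (R / 2)), by positivity, fun f M hf hM => ?_⟩
    rw [← norm_iteratedFDeriv_fderiv]
    refine (h (fderiv ℂ f) (2 * M / (R / 2)) hf.fderiv_of_complex fun z hz => ?_).trans
      (le_of_eq (by ring))
    have := norm_fderiv_le_of_norm_le_on_larger_ball (half_lt_self hR) hf.differentiableOn hM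
      (ball_subset_closedBall hz)
    rwa [show R - R / 2 = R / 2 by ring] at this

/-- The leading Taylor term of a function of one variable vanishing to order `m`. -/
theorem norm_sub_leading_term_le {F : Type*} [NormedAddCommGroup F] [NormedSpace ℂ F]
    [CompleteSpace F] {s : ℂ → F} (hs : Differentiable ℂ s) {m : ℕ} {C : ℝ}
    (h : ∀ t ∈ ball (0 : ℂ) 1, ‖s t‖ ≤ C * ‖t‖ ^ m) {t : ℂ} (ht : t ∈ ball (0 : ℂ) 1) :
    ‖s t - (m.factorial : ℂ)⁻¹ • t ^ m • iteratedDeriv m s 0‖ ≤ 4 * C * ‖t‖ ^ (m + 1) := by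
  have hC : 0 ≤ C := by
    have := (norm_nonneg _).trans (h (1 / 2) (by simp; norm_num))
    exact nonneg_of_mul_nonneg_left this (by simp)
  -- Letting `r → 1` in this estimate bounds every Taylor coefficient by `C`; letting `r → 0` kills
  -- those of order below `m`.
  have hcauchy : ∀ n, ∀ r ∈ Set.Ioo (0 : ℝ) 1,
      ‖(n.factorial : ℂ)⁻¹ • iteratedDeriv n s 0‖ * r ^ n ≤ C * r ^ m := by
    intro n r hr
    have h1 := Complex.norm_iteratedDeriv_le_of_forall_mem_sphere_norm_le n hr.1
      hs.diffContOnCl (C := C * r ^ m) (c := 0) fun z hz => by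
        have hz' : ‖z‖ = r := by simpa using hz
        have := h z (by simpa [hz'] using hr.2)
        rwa [hz'] at this
    have hrn : 0 < r ^ n := pow_pos hr.1 n
    have hn : (0 : ℝ) < n.factorial := by exact_mod_cast n.factorial_pos
    rw [norm_smul, norm_inv, Complex.norm_natCast]
    rw [le_div_iff₀ hrn] at h1
    rw [mul_assoc, inv_mul_le_iff₀ hn]
    exact h1
  have hle : ∀ n, m ≤ n → ‖(n.factorial : ℂ)⁻¹ • iteratedDeriv n s 0‖ ≤ C := by
    intro n hn
    have h1 : Tendsto (fun r : ℝ => ‖(n.factorial : ℂ)⁻¹ • iteratedDeriv n s 0‖ * r ^ n)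
        (𝓝[<] 1) (𝓝 (‖(n.factorial : ℂ)⁻¹ • iteratedDeriv n s 0‖ * 1 ^ n)) :=
      (Continuous.tendsto (by fun_prop) 1).mono_left nhdsWithin_le_nhds
    have h2 : Tendsto (fun r : ℝ => C * r ^ m) (𝓝[<] 1) (𝓝 (C * 1 ^ m)) :=
      (Continuous.tendsto (by fun_prop) 1).mono_left nhdsWithin_le_nhds
    have := le_of_tendsto_of_tendsto h1 h2 (by
      filter_upwards [Ioo_mem_nhdsLT (zero_lt_one (α := ℝ))] with r hr using hcauchy n r hr)
    simpa using this
  have hzero : ∀ n, n < m → (n.factorial : ℂ)⁻¹ • iteratedDeriv n s 0 = 0 := by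
    intro n hn
    have h2 : Tendsto (fun r : ℝ => C * r ^ (m - n)) (𝓝[>] 0) (𝓝 (C * 0 ^ (m - n))) :=
      (Continuous.tendsto (by fun_prop) 0).mono_left nhdsWithin_le_nhds
    rw [zero_pow (by omega), mul_zero] at h2
    have := ge_of_tendsto h2 (b := ‖(n.factorial : ℂ)⁻¹ • iteratedDeriv n s 0‖) (by
      filter_upwards [Ioo_mem_nhdsGT (zero_lt_one (α := ℝ))] with r hr
      have h3 := hcauchy n r hr
      have hrn : 0 < r ^ n := pow_pos hr.1 n
      rw [show m = (m - n) + n by omega, pow_add, ← mul_assoc] at h3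
      exact le_of_mul_le_mul_right h3 hrn)
    exact norm_le_zero_iff.1 this
  have ht1 : ‖t‖ < 1 := by simpa using ht
  -- For small `t` the Taylor tail is dominated by a geometric series. For `‖t‖ > 1 / 2` a missing
  -- factor `‖t‖` costs only a factor `2`.
  rcases le_or_gt ‖t‖ (1 / 2) with htl | htl
  · have hsum := Complex.hasSum_taylorSeries_on_ball (r := 1) hs.differentiableOn ht
    rw [← hasSum_nat_add_iff' (m + 1), Finset.sum_range_succ, Finset.sum_eq_zero, zero_add] at hsum
    · rw [sub_zero] at hsum
      rw [← hsum.tsum_eq]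
      have hg := (hasSum_geometric_of_lt_one (norm_nonneg t) ht1).mul_left (C * ‖t‖ ^ (m + 1))
      refine (tsum_of_norm_bounded hg fun i => ?_).trans ?_
      · have h4 := hle (i + (m + 1)) (by omega)
        rw [smul_comm, norm_smul, norm_pow]
        calc ‖t‖ ^ (i + (m + 1)) * _ ≤ ‖t‖ ^ (i + (m + 1)) * C := by gcongr
          _ = _ := by ring
      · have : (1 - ‖t‖)⁻¹ ≤ 4 := by
          rw [inv_le_comm₀ (by linarith) (by norm_num)]; linarith
        calc C * ‖t‖ ^ (m + 1) * (1 - ‖t‖)⁻¹ ≤ C * ‖t‖ ^ (m + 1) * 4 := by gcongr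
          _ = _ := by ring
    · intro n hn
      rw [smul_comm, hzero n (Finset.mem_range.1 hn), smul_zero]
  · have h1 := h t ht
    have h2 := hle m le_rfl
    calc _ ≤ ‖s t‖ + ‖(m.factorial : ℂ)⁻¹ • t ^ m • iteratedDeriv m s 0‖ := norm_sub_le _ _
      _ ≤ C * ‖t‖ ^ m + ‖t‖ ^ m * C := by
        rw [smul_comm, norm_smul, norm_pow]; gcongr
      _ = 2 * (C * ‖t‖ ^ m) := by ring
      _ ≤ 2 * (C * ‖t‖ ^ m) * (2 * ‖t‖) := le_mul_of_one_le_right (by positivity) (by linarith)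
      _ = _ := by ring

/-- The leading Taylor term of an entire map vanishing to order `m` at the origin. -/
theorem norm_sub_iteratedFDeriv_le {E : Type} [NormedAddCommGroup E] [NormedSpace ℂ E]
    [FiniteDimensional ℂ E] {F : Type} [NormedAddCommGroup F] [NormedSpace ℂ F] [CompleteSpace F]
    {f : E → F} (hf : Differentiable ℂ f) {m : ℕ} {C : ℝ}
    (h : ∀ z ∈ ball (0 : E) 1, ‖f z‖ ≤ C * ‖z‖ ^ m) {z : E} (hz : z ∈ ball (0 : E) 1) :
    ‖f z - (m.factorial : ℂ)⁻¹ • iteratedFDeriv ℂ m f 0 (fun _ => z)‖ ≤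
      4 * C * ‖z‖ ^ (m + 1) := by
  rcases eq_or_ne z 0 with rfl | hz0
  · rcases Nat.eq_zero_or_pos m with rfl | hm
    · simp
    · have : f 0 = 0 := by
        have := h 0 (mem_ball_self one_pos)
        rw [norm_zero, zero_pow hm.ne', mul_zero] at this
        exact norm_le_zero_iff.1 this
      rw [this, (iteratedFDeriv ℂ m f 0).map_coord_zero ⟨0, hm⟩ rfl]
      simp
  have hzn : 0 < ‖z‖ := norm_pos_iff.2 hz0
  set e : E := ((‖z‖ : ℂ)⁻¹) • z with he
  have hen : ‖e‖ = 1 := by rw [he, norm_smul]; simp [hzn.ne']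
  have hze : z = (‖z‖ : ℂ) • e := by
    rw [he, smul_inv_smul₀]; exact_mod_cast hzn.ne'
  -- Restricting to the complex line through `z` reduces the claim to one variable, with the same
  -- constant because `e` is a unit vector.
  let L : ℂ →L[ℂ] E := ContinuousLinearMap.smulRight (1 : ℂ →L[ℂ] ℂ) e
  have hL : ∀ t, L t = t • e := fun t => by simp [L]
  have key := norm_sub_leading_term_le (s := f ∘ L) (hf.comp L.differentiable) (m := m) (C := C)
    (fun t ht => by
      have := h (t • e) (by simpa [norm_smul, hen] using ht)
      simpa [hL, norm_smul, hen] using this) (t := (‖z‖ : ℂ)) (by simpa using hz)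
  rw [iteratedDeriv_eq_iteratedFDeriv,
    L.iteratedFDeriv_comp_right (hf.contDiff_of_complex m) 0 le_rfl] at key
  simp only [Function.comp_apply, hL, ← hze, Complex.norm_real, norm_norm,
    ContinuousMultilinearMap.compContinuousLinearMap_apply, one_smul, zero_smul] at key
  have h2 : iteratedFDeriv ℂ m f 0 (fun _ => z) =
      (‖z‖ : ℂ) ^ m • iteratedFDeriv ℂ m f 0 (fun _ => e) := by
    conv_lhs => rw [hze]
    rw [(iteratedFDeriv ℂ m f 0).map_smul_univ (fun _ => (‖z‖ : ℂ)) (fun _ => e)]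
    simp
  rw [h2]
  exact key

/-! ### Bounded solutions of backward linear recurrences -/

section TriangularSystems

/-- Iterating the recurrence into the future gives the series `∑ a_n ⋯ a_{n+i-1} c_{n+i}`, dominated
by a geometric one. No initial value is prescribed; boundedness replaces it. -/
theorem exists_bounded_solution_of_contraction {θ M : ℝ} (hθ : θ < 1) {a c : ℕ → ℂ}
    (ha : ∀ n, ‖a n‖ ≤ θ) (hc : ∀ n, ‖c n‖ ≤ M) :
    ∃ x : ℕ → ℂ, (∀ n, ‖x n‖ ≤ M * (1 - θ)⁻¹) ∧ ∀ n, x n = a n * x (n + 1) + c n := by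
  have hθ0 : 0 ≤ θ := (norm_nonneg _).trans (ha 0)
  let u : ℕ → ℕ → ℂ := fun n i => (∏ l ∈ Finset.range i, a (n + l)) * c (n + i)
  have hu : ∀ n i, ‖u n i‖ ≤ M * θ ^ i := fun n i => by
    have h1 : ‖∏ l ∈ Finset.range i, a (n + l)‖ ≤ θ ^ i := by
      rw [norm_prod]
      refine (Finset.prod_le_prod (fun _ _ => norm_nonneg _) fun l _ => ha (n + l)).trans ?_
      simp
    calc ‖u n i‖ = ‖∏ l ∈ Finset.range i, a (n + l)‖ * ‖c (n + i)‖ := norm_mul _ _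
      _ ≤ θ ^ i * M := mul_le_mul h1 (hc _) (norm_nonneg _) (by positivity)
      _ = _ := mul_comm _ _
  have hg : HasSum (fun i => M * θ ^ i) (M * (1 - θ)⁻¹) :=
    (hasSum_geometric_of_lt_one hθ0 hθ).mul_left M
  have hs : ∀ n, Summable (u n) := fun n => Summable.of_norm_bounded hg.summable (hu n)
  refine ⟨fun n => ∑' i, u n i, fun n => tsum_of_norm_bounded hg (hu n), fun n => ?_⟩
  have h0 : u n 0 = c n := by simp [u]
  have h1 : ∀ i, u n (i + 1) = a n * u (n + 1) i := fun i => by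
    simp only [u, Finset.prod_range_succ', add_zero]
    rw [Finset.prod_congr rfl fun l _ => by rw [show n + (l + 1) = n + 1 + l by omega],
      show n + (i + 1) = n + 1 + i by omega]
    ring
  beta_reduce
  rw [(hs n).tsum_eq_zero_add, h0]
  simp only [h1, tsum_mul_left]
  ring

/-- Bounded solutions of a triangular system of linear recurrences which run backwards in time and
contract along the diagonal. -/
theorem exists_bounded_solution_of_triangular {I : Type*} [Fintype I] (r : I → ℕ) (S : Set I)
    {θ M : ℝ} (hθ : θ < 1) {T U : ℕ → I → I → ℂ} {c : ℕ → I → ℂ}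
    (hT : ∀ n p q, ‖T n p q‖ ≤ M) (hU : ∀ n p q, ‖U n p q‖ ≤ M) (hc : ∀ n p, ‖c n p‖ ≤ M)
    (hTr : ∀ n p q, T n p q ≠ 0 → q = p ∨ r q < r p) (hUr : ∀ n p q, U n p q ≠ 0 → r q < r p)
    (hd : ∀ n, ∀ p ∈ S, ‖T n p p‖ ≤ θ) :
    ∃ (x : ℕ → I → ℂ) (B : ℝ), (∀ n p, ‖x n p‖ ≤ B) ∧ (∀ n, ∀ p ∉ S, x n p = 0) ∧
      ∀ n, ∀ p ∈ S, x n p = ∑ q, T n p q * x (n + 1) q + ∑ q, U n p q * x n q + c n p := by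
  classical
  -- Solve by increasing rank: for an unknown of rank `L` all off-diagonal terms involve lower rank,
  -- so they are a known bounded forcing `e` in a scalar recurrence. Unknowns outside `S` are set to
  -- zero.
  suffices h : ∀ L : ℕ, ∃ (x : ℕ → I → ℂ) (B : ℝ), (∀ n p, ‖x n p‖ ≤ B) ∧
      (∀ n, ∀ p ∉ S, x n p = 0) ∧ ∀ n, ∀ p ∈ S, r p < L →
        x n p = ∑ q, T n p q * x (n + 1) q + ∑ q, U n p q * x n q + c n p by
    obtain ⟨x, B, h1, h2, h3⟩ := h (Finset.univ.sup r + 1)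
    exact ⟨x, B, h1, h2, fun n p hp =>
      h3 n p hp (Nat.lt_succ_of_le (Finset.le_sup (Finset.mem_univ p)))⟩
  intro L
  induction L with
  | zero => exact ⟨fun _ _ => 0, 0, by simp, by simp, by simp⟩
  | succ L ih =>
    obtain ⟨x, B, hB, hx0, hx⟩ := ih
    let e : ℕ → I → ℂ := fun n p =>
      ∑ q ∈ Finset.univ.erase p, T n p q * x (n + 1) q + ∑ q, U n p q * x n q + c n p
    let N : ℝ := ∑ _q : I, M * B + ∑ _q : I, M * B + M
    have he : ∀ n p, ‖e n p‖ ≤ N := fun n p => by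
      have hM : 0 ≤ M := (norm_nonneg _).trans (hc n p)
      have hB0 : 0 ≤ B := (norm_nonneg _).trans (hB n p)
      refine (norm_add₃_le).trans (add_le_add_three ?_ ?_ (hc n p))
      · refine (norm_sum_le _ _).trans ((Finset.sum_le_sum fun q _ => ?_).trans
          (Finset.sum_le_sum_of_subset_of_nonneg (Finset.erase_subset p _)
            fun _ _ _ => mul_nonneg hM hB0))
        rw [norm_mul]
        exact mul_le_mul (hT n p q) (hB _ q) (norm_nonneg _) hM
      · refine (norm_sum_le _ _).trans (Finset.sum_le_sum fun q _ => ?_)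
        rw [norm_mul]
        exact mul_le_mul (hU n p q) (hB _ q) (norm_nonneg _) hM
    have hsol : ∀ p ∈ S, ∃ y : ℕ → ℂ, (∀ n, ‖y n‖ ≤ N * (1 - θ)⁻¹) ∧
        ∀ n, y n = T n p p * y (n + 1) + e n p := fun p hp =>
      exists_bounded_solution_of_contraction hθ (fun n => hd n p hp) fun n => he n p
    choose! y hyB hy using hsol
    let x' : ℕ → I → ℂ := fun n p => if p ∈ S ∧ r p = L then y p n else x n p
    have hlow : ∀ n p, r p ≠ L → x' n p = x n p := fun n p hp => if_neg fun h => hp h.2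
    refine ⟨x', max B (N * (1 - θ)⁻¹), fun n p => ?_, fun n p hp => ?_, fun n p hp hr => ?_⟩
    · simp only [x']
      split_ifs with h
      · exact (hyB p h.1 n).trans (le_max_right _ _)
      · exact (hB n p).trans (le_max_left _ _)
    · simp only [x']
      rw [if_neg fun h => hp h.1, hx0 n p hp]
    · have hUeq : ∑ q, U n p q * x' n q = ∑ q, U n p q * x n q := by
        refine Finset.sum_congr rfl fun q _ => ?_
        by_cases h : U n p q = 0
        · simp [h]
        · rw [hlow n q]
          have := hUr n p q h
          omega
      have hTeq : ∑ q ∈ Finset.univ.erase p, T n p q * x' (n + 1) q =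
          ∑ q ∈ Finset.univ.erase p, T n p q * x (n + 1) q := by
        refine Finset.sum_congr rfl fun q hq => ?_
        by_cases h : T n p q = 0
        · simp [h]
        · rw [hlow _ q]
          have := (hTr n p q h).resolve_left (Finset.ne_of_mem_erase hq)
          omega
      rw [hUeq, ← Finset.add_sum_erase _ _ (Finset.mem_univ p), hTeq]
      rcases Nat.lt_succ_iff_lt_or_eq.1 hr with h | h
      · rw [hlow n p h.ne, hlow _ p h.ne, hx n p hp h, ← Finset.add_sum_erase _ _ (Finset.mem_univ p)]
      · have h1 : ∀ n, x' n p = y p n := fun n => if_pos ⟨hp, h⟩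
        rw [h1, h1, hy p hp n]
        simp only [e]
        ring

end TriangularSystems

/-! ### Coordinates in complex Euclidean space -/

section Coordinates

variable {k : ℕ}

theorem CSpace.norm_apply_le (z : CSpace k) (i : Fin k) : ‖z i‖ ≤ ‖z‖ := PiLp.norm_apply_le z i

theorem CSpace.eq_sum_single (z : CSpace k) :
    z = ∑ i, z i • (EuclideanSpace.single i 1 : CSpace k) := by
  ext j
  simp [Pi.single_apply]

theorem CSpace.norm_le_sum (z : CSpace k) : ‖z‖ ≤ ∑ i, ‖z i‖ := by
  conv_lhs => rw [CSpace.eq_sum_single z]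
  refine (norm_sum_le _ _).trans (Finset.sum_le_sum fun i _ => ?_)
  simp [norm_smul]

theorem CSpace.norm_le_of_forall {z : CSpace k} {B : ℝ} (h : ∀ i, ‖z i‖ ≤ B) : ‖z‖ ≤ k * B := by
  refine (CSpace.norm_le_sum z).trans ((Finset.sum_le_sum fun i _ => h i).trans ?_)
  simp

theorem CSpace.clm_apply (A : CSpace k →L[ℂ] CSpace k) (z : CSpace k) (i : Fin k) :
    A z i = ∑ j, A (EuclideanSpace.single j 1) i * z j := by
  conv_lhs => rw [CSpace.eq_sum_single z, map_sum]
  simp [mul_comm]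

theorem CSpace.differentiable_iff {E : Type*} [NormedAddCommGroup E] [NormedSpace ℂ E]
    {f : E → CSpace k} : Differentiable ℂ f ↔ ∀ i, Differentiable ℂ fun x => f x i :=
  differentiable_euclidean

end Coordinates

/-! ### Homogeneous polynomial maps as coefficient tensors -/

section HomogeneousMaps

variable {k m : ℕ}

/-- The homogeneous polynomial map with components `∑ t_{j,f} z_{f 0} ⋯ z_{f (m-1)}`. -/
noncomputable def tensorMap (t : Fin k → (Fin m → Fin k) → ℂ) (z : CSpace k) : CSpace k :=
  WithLp.toLp 2 fun j => ∑ f, t j f * ∏ s, z (f s)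

/-- The polynomials which define `tensorMap t`. -/
noncomputable def tensorPoly (t : Fin k → (Fin m → Fin k) → ℂ) : PolyMap k :=
  fun j => ∑ f, MvPolynomial.C (t j f) * ∏ s, MvPolynomial.X (f s)

theorem tensorMap_apply (t : Fin k → (Fin m → Fin k) → ℂ) (z : CSpace k) (j : Fin k) :
    tensorMap t z j = ∑ f, t j f * ∏ s, z (f s) := rfl

theorem toMap_tensorPoly (t : Fin k → (Fin m → Fin k) → ℂ) :
    (tensorPoly t).toMap = tensorMap t := by
  funext z
  simp [PolyMap.toMap, tensorPoly, tensorMap]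

theorem prod_X_eq_monomial (f : Fin m → Fin k) :
    ∏ s, (MvPolynomial.X (f s) : MvPolynomial (Fin k) ℂ) =
      MvPolynomial.monomial (∑ s, Finsupp.single (f s) 1) 1 :=
  (MvPolynomial.monomial_sum_one _ _).symm

theorem boundedSeq_tensorPoly {t : ℕ → Fin k → (Fin m → Fin k) → ℂ} {B : ℝ}
    (hB : ∀ n j f, ‖t n j f‖ ≤ B) : PolyMap.BoundedSeq fun n => tensorPoly (t n) := by
  -- Tensors are not symmetrized: several `f` may give the same monomial, so a coefficient is
  -- bounded by the sum over all `f`.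
  refine ⟨m, ∑ _f : Fin m → Fin k, B, fun n j => ⟨?_, fun α => ?_⟩⟩
  · refine MvPolynomial.totalDegree_finsetSum_le fun f _ => ?_
    refine (MvPolynomial.totalDegree_mul _ _).trans ?_
    rw [MvPolynomial.totalDegree_C, zero_add]
    refine (MvPolynomial.totalDegree_finsetProd _ _).trans ?_
    simp
  · simp only [tensorPoly, MvPolynomial.coeff_sum]
    refine (norm_sum_le _ _).trans (Finset.sum_le_sum fun f _ => ?_)
    rw [MvPolynomial.coeff_C_mul, prod_X_eq_monomial, MvPolynomial.coeff_monomial]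
    split_ifs
    · simpa using hB n j f
    · simpa using (norm_nonneg _).trans (hB n j f)

theorem norm_prod_sub_prod_le (f : Fin m → Fin k) (u v : CSpace k) :
    ‖∏ s, u (f s) - ∏ s, v (f s)‖ ≤ m * max ‖u‖ ‖v‖ ^ (m - 1) * ‖u - v‖ := by
  have h := (ContinuousMultilinearMap.mkPiAlgebra ℂ (Fin m) ℂ).norm_image_sub_le
    (fun s => u (f s)) (fun s => v (f s))
  simp only [ContinuousMultilinearMap.mkPiAlgebra_apply, Fintype.card_fin] at h
  refine h.trans ?_
  have hpi : ∀ w : CSpace k, ‖fun s => w (f s)‖ ≤ ‖w‖ := fun w =>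
    (pi_norm_le_iff_of_nonneg (norm_nonneg w)).2 fun s => CSpace.norm_apply_le w _
  have h1 : ‖(fun s => u (f s)) - fun s => v (f s)‖ ≤ ‖u - v‖ := hpi (u - v)
  have h2 : ‖ContinuousMultilinearMap.mkPiAlgebra ℂ (Fin m) ℂ‖ ≤ 1 :=
    ContinuousMultilinearMap.norm_mkPiAlgebra.le
  have h3 : max ‖fun s => u (f s)‖ ‖fun s => v (f s)‖ ≤ max ‖u‖ ‖v‖ := max_le_max (hpi u) (hpi v)
  calc _ ≤ 1 * m * max ‖u‖ ‖v‖ ^ (m - 1) * ‖u - v‖ := by gcongr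
    _ = _ := by ring

theorem norm_tensorMap_sub_le {t : Fin k → (Fin m → Fin k) → ℂ} {B : ℝ}
    (hB : ∀ j f, ‖t j f‖ ≤ B) (u v : CSpace k) :
    ‖tensorMap t u - tensorMap t v‖ ≤
      (k * k ^ m * m * B) * max ‖u‖ ‖v‖ ^ (m - 1) * ‖u - v‖ := by
  have h : ∀ j, ‖(tensorMap t u - tensorMap t v) j‖ ≤
      ∑ _f : Fin m → Fin k, B * (m * max ‖u‖ ‖v‖ ^ (m - 1) * ‖u - v‖) := fun j => by
    rw [PiLp.sub_apply, tensorMap_apply, tensorMap_apply, ← Finset.sum_sub_distrib]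
    refine (norm_sum_le _ _).trans (Finset.sum_le_sum fun f _ => ?_)
    rw [← mul_sub, norm_mul]
    exact mul_le_mul (hB j f) (norm_prod_sub_prod_le f u v) (norm_nonneg _)
      ((norm_nonneg _).trans (hB j f))
  refine (CSpace.norm_le_of_forall h).trans (le_of_eq ?_)
  simp
  ring

theorem tensorMap_zero_right (hm : m ≠ 0) (t : Fin k → (Fin m → Fin k) → ℂ) :
    tensorMap t 0 = 0 := by
  ext j
  rw [tensorMap_apply, PiLp.zero_apply]
  refine Finset.sum_eq_zero fun f _ => ?_
  rw [Finset.prod_eq_zero (Finset.mem_univ ⟨0, Nat.pos_of_ne_zero hm⟩) (by simp), mul_zero]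

theorem norm_tensorMap_le (hm : m ≠ 0) {t : Fin k → (Fin m → Fin k) → ℂ} {B : ℝ}
    (hB : ∀ j f, ‖t j f‖ ≤ B) (u : CSpace k) :
    ‖tensorMap t u‖ ≤ (k * k ^ m * m * B) * ‖u‖ ^ m := by
  have h := norm_tensorMap_sub_le hB u 0
  rw [tensorMap_zero_right hm, sub_zero, sub_zero, norm_zero, max_eq_left (norm_nonneg u)] at h
  refine h.trans (le_of_eq ?_)
  obtain ⟨n, rfl⟩ := Nat.exists_eq_succ_of_ne_zero hm
  simp only [Nat.succ_sub_one, Nat.succ_eq_add_one, pow_succ]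
  ring

/-- Together with `clm_comp_tensorMap`, this turns the homological equation into a linear system for
tensor coefficients. -/
theorem tensorMap_comp_clm (t : Fin k → (Fin m → Fin k) → ℂ) (A : CSpace k →L[ℂ] CSpace k)
    (z : CSpace k) : tensorMap t (A z) = tensorMap (fun j f => ∑ g : Fin m → Fin k,
      t j g * ∏ s, A (EuclideanSpace.single (f s) 1) (g s)) z := by
  ext j
  simp only [tensorMap_apply, CSpace.clm_apply A z, Finset.prod_univ_sum, Fintype.piFinset_univ,
    Finset.prod_mul_distrib, Finset.mul_sum, Finset.sum_mul]
  rw [Finset.sum_comm]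
  exact Finset.sum_congr rfl fun f _ => Finset.sum_congr rfl fun g _ => by ring

theorem clm_comp_tensorMap (t : Fin k → (Fin m → Fin k) → ℂ) (A : CSpace k →L[ℂ] CSpace k)
    (z : CSpace k) : A (tensorMap t z) = tensorMap (fun j f => ∑ i,
      A (EuclideanSpace.single i 1) j * t i f) z := by
  ext j
  simp only [tensorMap_apply, CSpace.clm_apply A (tensorMap t z), Finset.mul_sum, Finset.sum_mul]
  rw [Finset.sum_comm]
  exact Finset.sum_congr rfl fun f _ => Finset.sum_congr rfl fun g _ => by ring

theorem multilinear_eq_tensorMap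
    (T : ContinuousMultilinearMap ℂ (fun _ : Fin m => CSpace k) (CSpace k)) (z : CSpace k) :
    T (fun _ => z) =
      tensorMap (fun j f => T (fun s => EuclideanSpace.single (f s) 1) j) z := by
  conv_lhs => rw [CSpace.eq_sum_single z]
  rw [T.map_sum]
  ext j
  simp only [T.map_smul_univ, tensorMap_apply]
  simp [mul_comm]

end HomogeneousMaps

theorem hasFDerivAt_zero_of_norm_sub_le_sq {E F : Type*} [NormedAddCommGroup E] [NormedSpace ℂ E]
    [NormedAddCommGroup F] [NormedSpace ℂ F] {f : E → F} {A : E →L[ℂ] F} {C : ℝ}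
    (h : ∀ z, ‖z‖ < 1 → ‖f z - A z‖ ≤ C * ‖z‖ ^ 2) : HasFDerivAt f A 0 := by
  have h0 : f 0 = 0 := by
    have := h 0 (by simp)
    simpa using this
  rw [hasFDerivAt_iff_isLittleO_nhds_zero]
  have h1 : (fun z : E => f z - A z) =O[𝓝 0] fun z => ‖z‖ ^ 2 := by
    refine Asymptotics.IsBigO.of_bound C ?_
    filter_upwards [ball_mem_nhds (0 : E) one_pos] with z hz
    simpa using h z (by simpa using hz)
  have h2 : (fun z : E => ‖z‖ ^ 2) =o[𝓝 0] fun z => z := by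
    have := (Asymptotics.isLittleO_pow_id (𝕜 := ℝ) (n := 2) (by norm_num)).comp_tendsto
      (tendsto_norm_zero (E := E))
    exact this.trans_isBigO (Asymptotics.isBigO_refl _ _).norm_left
  simpa [h0] using h1.trans_isLittleO h2

/-! ### Polynomial maps: growth, boundedness, triangular form -/

namespace PolyMap

variable {k : ℕ}

theorem toMap_apply (P : PolyMap k) (z : CSpace k) (j : Fin k) :
    P.toMap z j = MvPolynomial.eval (fun i => z i) (P j) := rfl

theorem toMap_add (P Q : PolyMap k) (z : CSpace k) :
    PolyMap.toMap (P + Q) z = P.toMap z + Q.toMap z := by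
  ext j
  simp [toMap_apply]

theorem differentiable_eval (p : MvPolynomial (Fin k) ℂ) :
    Differentiable ℂ fun z : CSpace k => MvPolynomial.eval (fun i => z i) p := by
  induction p using MvPolynomial.induction_on with
  | C a => simp
  | add p q hp hq =>
    simp only [map_add]
    exact hp.add hq
  | mul_X p i hp =>
    simp only [map_mul, MvPolynomial.eval_X]
    exact hp.mul (by fun_prop)

theorem differentiable_toMap (P : PolyMap k) : Differentiable ℂ P.toMap := by
  rw [CSpace.differentiable_iff]
  exact fun j => differentiable_eval (P j)

theorem norm_eval_le {p : MvPolynomial (Fin k) ℂ} {d : ℕ} {M : ℝ} (hd : p.totalDegree ≤ d)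
    (hM : ∀ α, ‖p.coeff α‖ ≤ M) (z : CSpace k) :
    ‖MvPolynomial.eval (fun i => z i) p‖ ≤
      (Finset.Iic (Finsupp.equivFunOnFinite.symm fun _ : Fin k => d)).card * M *
        (1 + ‖z‖) ^ d := by
  have hM0 : 0 ≤ M := (norm_nonneg _).trans (hM 0)
  have hz : 1 ≤ 1 + ‖z‖ := by linarith [norm_nonneg z]
  have hle : ∀ α ∈ p.support, (α.sum fun _ e => e) ≤ d := fun α hα =>
    (MvPolynomial.le_totalDegree hα).trans hd
  have hsub : p.support ⊆ Finset.Iic (Finsupp.equivFunOnFinite.symm fun _ : Fin k => d) := by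
    intro α hα
    rw [Finset.mem_Iic, Finsupp.le_iff]
    intro i hi
    refine le_trans ?_ (hle α hα)
    exact Finset.single_le_sum (f := fun i => α i) (fun _ _ => Nat.zero_le _) hi
  rw [MvPolynomial.eval_eq]
  have hterm : ∀ α ∈ p.support, ‖p.coeff α * ∏ i ∈ α.support, z i ^ α i‖ ≤ M * (1 + ‖z‖) ^ d := by
    intro α hα
    rw [norm_mul, norm_prod]
    refine mul_le_mul (hM α) ?_ (Finset.prod_nonneg fun _ _ => norm_nonneg _) hM0
    calc ∏ i ∈ α.support, ‖z i ^ α i‖ ≤ ∏ i ∈ α.support, (1 + ‖z‖) ^ α i := by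
          refine Finset.prod_le_prod (fun _ _ => norm_nonneg _) fun i _ => ?_
          rw [norm_pow]
          have := CSpace.norm_apply_le z i
          gcongr
          linarith
      _ = (1 + ‖z‖) ^ (α.sum fun _ e => e) := by
          rw [Finset.prod_pow_eq_pow_sum]; rfl
      _ ≤ (1 + ‖z‖) ^ d := pow_le_pow_right₀ hz (hle α hα)
  refine (norm_sum_le _ _).trans ((Finset.sum_le_sum hterm).trans ?_)
  rw [Finset.sum_const, nsmul_eq_mul, ← mul_assoc]
  have := Finset.card_le_card hsub
  gcongr

theorem BoundedSeq.exists_norm_toMap_le {P : ℕ → PolyMap k} (hP : BoundedSeq P) :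
    ∃ (C : ℝ) (d : ℕ), 0 ≤ C ∧ ∀ n z, ‖(P n).toMap z‖ ≤ C * (1 + ‖z‖) ^ d := by
  obtain ⟨d, M, h⟩ := hP
  refine ⟨k * ((Finset.Iic (Finsupp.equivFunOnFinite.symm fun _ : Fin k => d)).card * max M 0), d,
    by positivity, fun n z => ?_⟩
  refine (CSpace.norm_le_of_forall fun j => norm_eval_le (h n j).1
    (fun α => ((h n j).2 α).trans (le_max_left M 0)) z).trans (le_of_eq ?_)
  ring

theorem BoundedSeq.exists_norm_toMap_le_on_ball {P : ℕ → PolyMap k} (hP : BoundedSeq P) (R : ℝ) :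
    ∃ M : ℝ, 0 ≤ M ∧ ∀ n z, ‖z‖ ≤ R → ‖(P n).toMap z‖ ≤ M := by
  obtain ⟨C, d, hC, h⟩ := hP.exists_norm_toMap_le
  refine ⟨C * (1 + |R|) ^ d, by positivity, fun n z hz => (h n z).trans ?_⟩
  have := hz.trans (le_abs_self R)
  gcongr

theorem BoundedSeq.add {P Q : ℕ → PolyMap k} (hP : BoundedSeq P) (hQ : BoundedSeq Q) :
    BoundedSeq fun n => P n + Q n := by
  obtain ⟨d, M, h⟩ := hP
  obtain ⟨e, N, h'⟩ := hQ
  refine ⟨max d e, M + N, fun n j => ⟨?_, fun α => ?_⟩⟩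
  · exact (MvPolynomial.totalDegree_add _ _).trans (max_le_max (h n j).1 (h' n j).1)
  · simp only [Pi.add_apply, MvPolynomial.coeff_add]
    exact (norm_add_le _ _).trans (add_le_add ((h n j).2 α) ((h' n j).2 α))

/-- The components are `P_j(z) = c_j z_j + h_j(z_1, …, z_{j-1})`. -/
noncomputable def IsTriangularWith (P : PolyMap k) (c : Fin k → ℂ) : Prop :=
  ∀ j, ∃ h ∈ MvPolynomial.supported ℂ (Set.Iio j), P j = MvPolynomial.C (c j) * MvPolynomial.X j + h

theorem IsTriangularWith.add_tensorPoly {P : PolyMap k} {c : Fin k → ℂ}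
    (hP : P.IsTriangularWith c) {m : ℕ} {t : Fin k → (Fin m → Fin k) → ℂ}
    (ht : ∀ j f, (∃ s, j ≤ f s) → t j f = 0) : IsTriangularWith (P + tensorPoly t) c := by
  intro j
  obtain ⟨h, hh, e⟩ := hP j
  refine ⟨h + tensorPoly t j, add_mem hh (Subalgebra.sum_mem _ fun f _ => ?_), ?_⟩
  · by_cases hf : ∃ s, j ≤ f s
    · rw [ht j f hf]
      simp
    · push Not at hf
      exact Subalgebra.mul_mem _ (Subalgebra.algebraMap_mem _ _)
        (Subalgebra.prod_mem _ fun s _ => MvPolynomial.X_mem_supported.2 (hf s))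
  · rw [Pi.add_apply, e, add_assoc]

/-- The analytic trace of triangularity, and the only form of it that the dynamics of `G` requires.
-/
theorem IsTriangularWith.toMap_sub_eq {P : PolyMap k} {c : Fin k → ℂ}
    (hP : P.IsTriangularWith c) {j : Fin k} {z w : CSpace k} (hzw : ∀ i < j, z i = w i) :
    P.toMap z j - c j * z j = P.toMap w j - c j * w j := by
  obtain ⟨h, hh, e⟩ := hP j
  simp only [toMap_apply, e, map_add, map_mul, MvPolynomial.eval_C, MvPolynomial.eval_X,
    add_sub_cancel_left]
  refine MvPolynomial.eval₂Hom_congr' rfl (fun i hi _ => ?_) rfl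
  exact hzw i (MvPolynomial.mem_supported.1 hh hi)

/-- The linear polynomial map with the given matrix. -/
noncomputable def linear (A : CSpace k →L[ℂ] CSpace k) : PolyMap k :=
  tensorPoly (m := 1) fun j f => A (EuclideanSpace.single (f 0) 1) j

theorem toMap_linear (A : CSpace k →L[ℂ] CSpace k) : (linear A).toMap = A := by
  funext z
  rw [linear, toMap_tensorPoly]
  ext j
  rw [tensorMap_apply, CSpace.clm_apply, ← (Equiv.funUnique (Fin 1) (Fin k)).symm.sum_comp]
  simp

theorem isTriangularWith_linear {A : CSpace k →L[ℂ] CSpace k}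
    (hA : ∀ i j : Fin k, i < j → A (EuclideanSpace.single j 1) i = 0) :
    (linear A).IsTriangularWith fun j => A (EuclideanSpace.single j 1) j := by
  intro j
  refine ⟨∑ i ∈ Finset.univ.erase j, MvPolynomial.C (A (EuclideanSpace.single i 1) j) *
    MvPolynomial.X i, Subalgebra.sum_mem _ fun i hi => ?_, ?_⟩
  · rcases lt_or_gt_of_ne (Finset.ne_of_mem_erase hi) with h | h
    · exact Subalgebra.mul_mem _ (Subalgebra.algebraMap_mem _ _)
        (MvPolynomial.X_mem_supported.2 h)
    · rw [hA j i h]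
      simp
  · rw [Finset.add_sum_erase _ (fun i => MvPolynomial.C (A (EuclideanSpace.single i 1) j) *
      MvPolynomial.X i) (Finset.mem_univ j), linear, tensorPoly,
      ← (Equiv.funUnique (Fin 1) (Fin k)).symm.sum_comp]
    simp

theorem boundedSeq_linear {A : ℕ → CSpace k →L[ℂ] CSpace k} {B : ℝ}
    (hA : ∀ n, ‖A n‖ ≤ B) : BoundedSeq fun n => linear (A n) := by
  refine boundedSeq_tensorPoly (B := B) fun n j f => ?_
  refine (CSpace.norm_apply_le _ _).trans (((A n).le_opNorm _).trans ?_)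
  simpa using hA n

theorem IsTriangularWith.isLowerTriangular {P : PolyMap k} {c : Fin k → ℂ}
    (hP : P.IsTriangularWith c) (h0 : P.toMap 0 = 0) : P.IsLowerTriangular :=
  ⟨h0, fun j => let ⟨h, hh, e⟩ := hP j; ⟨c j, h, hh, e⟩⟩

end PolyMap

/-! ### The homological equation and the induction on the order of conjugation -/

section Homological

variable {k : ℕ}

/-- The polynomial maps `X_n = id + ⋯` conjugate `F_n` to `P_n = A_n + ⋯` up to order `m`. -/
structure ConjugatesUpTo (A : ℕ → CSpace k →L[ℂ] CSpace k) (F : ℕ → CSpace k → CSpace k)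
    (X P : ℕ → PolyMap k) (m : ℕ) : Prop where
  bounded_left : PolyMap.BoundedSeq X
  bounded_right : PolyMap.BoundedSeq P
  estimate : ∃ C : ℝ, 0 ≤ C ∧ ∀ n z, ‖z‖ < 1 →
    ‖(X n).toMap z - z‖ ≤ C * ‖z‖ ^ 2 ∧ ‖(P n).toMap z - A n z‖ ≤ C * ‖z‖ ^ 2 ∧
      ‖(X (n + 1)).toMap (F n z) - (P n).toMap ((X n).toMap z)‖ ≤ C * ‖z‖ ^ m

theorem conjugatesUpTo_two {A : ℕ → CSpace k →L[ℂ] CSpace k} {F : ℕ → CSpace k → CSpace k}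
    {B C : ℝ} (hA : ∀ n, ‖A n‖ ≤ B)
    (hF : ∀ n z, ‖z‖ < 1 → ‖F n z - A n z‖ ≤ C * ‖z‖ ^ 2) :
    ConjugatesUpTo A F (fun _ => PolyMap.linear (ContinuousLinearMap.id ℂ _))
      (fun n => PolyMap.linear (A n)) 2 where
  bounded_left := PolyMap.boundedSeq_linear (B := 1) fun _ => ContinuousLinearMap.norm_id_le
  bounded_right := PolyMap.boundedSeq_linear hA
  estimate := by
    refine ⟨|C|, abs_nonneg C, fun n z hz => ?_⟩
    simp only [PolyMap.toMap_linear, ContinuousLinearMap.id_apply, sub_self, norm_zero]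
    have := (hF n z hz).trans (mul_le_mul_of_nonneg_right (le_abs_self C) (by positivity))
    exact ⟨by positivity, by positivity, this⟩

/-- The defect is entire and vanishes to order `m` with a uniform constant, so Cauchy's estimates
bound its degree `m` Taylor term and the remainder uniformly in `n`. -/
theorem ConjugatesUpTo.exists_leading_tensor {A : ℕ → CSpace k →L[ℂ] CSpace k}
    {F : ℕ → CSpace k → CSpace k} {X P : ℕ → PolyMap k} {m : ℕ}
    (hF : ∀ n, Differentiable ℂ (F n)) (h : ConjugatesUpTo A F X P m) :
    ∃ (c : ℕ → Fin k → (Fin m → Fin k) → ℂ) (B : ℝ), (∀ n j f, ‖c n j f‖ ≤ B) ∧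
      ∀ n z, ‖z‖ < 1 →
        ‖(X (n + 1)).toMap (F n z) - (P n).toMap ((X n).toMap z) - tensorMap (c n) z‖ ≤
          B * ‖z‖ ^ (m + 1) := by
  obtain ⟨C, hC, hest⟩ := h.estimate
  obtain ⟨K, hK, hKm⟩ := exists_norm_iteratedFDeriv_le (E := CSpace k) m one_pos
  let D : ℕ → CSpace k → CSpace k := fun n z =>
    (X (n + 1)).toMap (F n z) - (P n).toMap ((X n).toMap z)
  have hD : ∀ n, Differentiable ℂ (D n) := fun n =>
    ((X (n + 1)).differentiable_toMap.comp (hF n)).sub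
      ((P n).differentiable_toMap.comp (X n).differentiable_toMap)
  have hDC : ∀ n, ∀ z ∈ ball (0 : CSpace k) 1, ‖D n z‖ ≤ C * ‖z‖ ^ m := fun n z hz =>
    (hest n z (by simpa using hz)).2.2
  let T : ℕ → ContinuousMultilinearMap ℂ (fun _ : Fin m => CSpace k) (CSpace k) := fun n =>
    (m.factorial : ℂ)⁻¹ • iteratedFDeriv ℂ m (D n) 0
  have hfac : ‖(m.factorial : ℂ)⁻¹‖ ≤ 1 := by
    rw [norm_inv, Complex.norm_natCast]
    exact inv_le_one_of_one_le₀ (by exact_mod_cast m.factorial_pos)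
  refine ⟨fun n j f => T n (fun s => EuclideanSpace.single (f s) 1) j, max (K * C) (4 * C),
    fun n j f => ?_, fun n z hz => ?_⟩
  · refine (CSpace.norm_apply_le _ _).trans (((T n).le_opNorm _).trans ?_)
    have h1 := hKm (D n) C (hD n) fun z hz => (hDC n z hz).trans (by
      have : ‖z‖ ^ m ≤ 1 := pow_le_one₀ (norm_nonneg z) (by simpa using (mem_ball.1 hz).le)
      nlinarith)
    have h2 : ‖T n‖ ≤ K * C := by
      simp only [T]
      rw [norm_smul]
      calc _ ≤ 1 * (K * C) := mul_le_mul hfac h1 (norm_nonneg _) zero_le_one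
        _ = _ := one_mul _
    refine le_trans ?_ (le_max_left _ _)
    simpa using h2
  · rw [← multilinear_eq_tensorMap]
    have h1 := norm_sub_iteratedFDeriv_le (hD n) (hDC n) (z := z) (by simpa using hz)
    refine h1.trans ?_
    have := le_max_right (K * C) (4 * C)
    gcongr

/-- Bounded solutions of the homological equation. -/
theorem exists_solution_homological {m : ℕ} {A : ℕ → CSpace k →L[ℂ] CSpace k} {a θ B : ℝ}
    (ha : 0 < a) (hθ : θ < 1) (hA : ∀ n, ‖A n‖ ≤ 1)
    (htri : ∀ n, ∀ i j : Fin k, i < j → A n (EuclideanSpace.single j 1) i = 0)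
    (hdiag : ∀ n j, a ≤ ‖A n (EuclideanSpace.single j 1) j‖)
    {S : Set (Fin k × (Fin m → Fin k))}
    (hS : ∀ n, ∀ p ∈ S, ‖∏ s, A n (EuclideanSpace.single (p.2 s) 1) (p.2 s)‖ ≤
      θ * ‖A n (EuclideanSpace.single p.1 1) p.1‖)
    {c : ℕ → Fin k → (Fin m → Fin k) → ℂ} (hc : ∀ n j f, ‖c n j f‖ ≤ B) :
    ∃ (t g : ℕ → Fin k → (Fin m → Fin k) → ℂ) (N : ℝ),
      (∀ n j f, ‖t n j f‖ ≤ N) ∧ (∀ n j f, ‖g n j f‖ ≤ N) ∧ (∀ n j f, (j, f) ∈ S → g n j f = 0) ∧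
      ∀ n z, tensorMap (c n) z + tensorMap (t (n + 1)) (A n z) - A n (tensorMap (t n) z) =
        tensorMap (g n) z := by
  classical
  set e : ℕ → Fin k → Fin k → ℂ := fun n i j => A n (EuclideanSpace.single j 1) i with he
  have he1 : ∀ n i j, ‖e n i j‖ ≤ 1 := fun n i j =>
    (CSpace.norm_apply_le _ _).trans (((A n).le_opNorm _).trans (by simpa using hA n))
  have hprod : ∀ n (f g : Fin m → Fin k), ‖∏ s, e n (g s) (f s)‖ ≤ 1 := fun n f g => by
    rw [norm_prod]
    exact Finset.prod_le_one (fun _ _ => norm_nonneg _) fun _ _ => he1 _ _ _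
  have hinv : ∀ n j, ‖(e n j j)⁻¹‖ ≤ a⁻¹ := fun n j => by
    rw [norm_inv]
    exact inv_anti₀ ha (hdiag n j)
  have hne : ∀ n j, e n j j ≠ 0 := fun n j h0 => by
    have := hdiag n j
    simp only [he] at h0
    rw [h0, norm_zero] at this
    linarith
  -- The homological equation for the coefficient `(j, f)`, divided by `λ_j`: `T` comes from
  -- precomposition with `A n` and acts at time `n + 1`, while `U` comes from the off-diagonal part
  -- of `A n` and acts at time `n`. The diagonal of `T` is `∏ λ_{f s} / λ_j`, at most `θ` on `S`.
  let T : ℕ → Fin k × (Fin m → Fin k) → Fin k × (Fin m → Fin k) → ℂ := fun n p q =>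
    if q.1 = p.1 then (e n p.1 p.1)⁻¹ * ∏ s, e n (q.2 s) (p.2 s) else 0
  let U : ℕ → Fin k × (Fin m → Fin k) → Fin k × (Fin m → Fin k) → ℂ := fun n p q =>
    if q.2 = p.2 then (if q.1 = p.1 then 0 else -((e n p.1 p.1)⁻¹ * e n p.1 q.1)) else 0
  -- By lower triangularity `T` only involves tensor indices `q.2 ≥ p.2` and `U` only components
  -- `q.1 < p.1`; both changes lower this rank.
  let r : Fin k × (Fin m → Fin k) → ℕ := fun p => p.1 + ∑ s, (k - p.2 s)
  have hai : 0 < a⁻¹ := inv_pos.2 ha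
  obtain ⟨x, Bx, hxB, hx0, hx⟩ := exists_bounded_solution_of_triangular r S hθ (T := T) (U := U)
    (c := fun n p => (e n p.1 p.1)⁻¹ * c n p.1 p.2) (M := max a⁻¹ (a⁻¹ * B))
    (fun n p q => by
      refine le_trans ?_ (le_max_left _ _)
      simp only [T]
      split_ifs
      · rw [norm_mul]
        exact (mul_le_mul (hinv _ _) (hprod _ _ _) (norm_nonneg _) hai.le).trans (mul_one _).le
      · simpa using hai.le)
    (fun n p q => by
      refine le_trans ?_ (le_max_left _ _)
      simp only [U]
      split_ifs
      · simpa using hai.le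
      · rw [norm_neg, norm_mul]
        exact (mul_le_mul (hinv _ _) (he1 _ _ _) (norm_nonneg _) hai.le).trans (mul_one _).le
      · simpa using hai.le)
    (fun n p => by
      refine le_trans ?_ (le_max_right _ _)
      rw [norm_mul]
      exact mul_le_mul (hinv _ _) (hc _ _ _) (norm_nonneg _) hai.le)
    (fun n p q hpq => by
      simp only [T, ne_eq, ite_eq_right_iff, not_forall] at hpq
      obtain ⟨h1, h2⟩ := hpq
      have h3 : ∀ s, p.2 s ≤ q.2 s := fun s => by
        by_contra hlt
        refine h2 ?_
        rw [Finset.prod_eq_zero (Finset.mem_univ s) (htri n _ _ (not_le.1 hlt)), mul_zero]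
      by_cases h4 : q.2 = p.2
      · exact Or.inl (Prod.ext h1 h4)
      · right
        obtain ⟨s, hs⟩ := Function.ne_iff.1 h4
        simp only [r, h1, add_lt_add_iff_left]
        refine Finset.sum_lt_sum (fun i _ => ?_) ⟨s, Finset.mem_univ s, ?_⟩
        · have := h3 i
          omega
        · have := lt_of_le_of_ne (h3 s) (Ne.symm hs)
          have := (q.2 s).2
          omega)
    (fun n p q hpq => by
      simp only [U, ne_eq, ite_eq_right_iff, not_forall] at hpq
      obtain ⟨h1, h2⟩ := hpq
      split_ifs at h2 with h3
      · exact absurd rfl h2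
      · have h4 : q.1 < p.1 := by
          refine lt_of_le_of_ne (not_lt.1 fun hlt => h2 ?_) h3
          simp only [he, htri n _ _ hlt, mul_zero, neg_zero]
        simp only [r, h1]
        have : (q.1 : ℕ) < p.1 := h4
        omega)
    (fun n p hp => by
      simp only [T, if_true]
      rw [norm_mul, norm_inv, inv_mul_le_iff₀ (norm_pos_iff.2 (hne n p.1)), mul_comm]
      exact hS n p hp)
  let t : ℕ → Fin k → (Fin m → Fin k) → ℂ := fun n j f => x n (j, f)
  -- What the correction fails to remove is by definition the new term of the normal form; the
  -- recurrence makes it vanish on `S`.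
  let g : ℕ → Fin k → (Fin m → Fin k) → ℂ := fun n j f =>
    c n j f + ∑ h : Fin m → Fin k, t (n + 1) j h * ∏ s, e n (h s) (f s) - ∑ i, e n j i * t n i f
  let N : ℝ := B + ∑ _h : Fin m → Fin k, Bx + ∑ _i : Fin k, Bx
  refine ⟨t, g, max Bx N, fun n j f => (hxB n _).trans (le_max_left _ _), fun n j f =>
    le_trans ?_ (le_max_right _ _), fun n j f hjf => ?_, fun n z => ?_⟩
  · refine (norm_sub_le _ _).trans (add_le_add ((norm_add_le _ _).trans
      (add_le_add (hc n j f) ?_)) ?_)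
    · refine (norm_sum_le _ _).trans (Finset.sum_le_sum fun h _ => ?_)
      rw [norm_mul]
      exact (mul_le_mul (hxB _ _) (hprod _ _ _) (norm_nonneg _)
        ((norm_nonneg _).trans (hxB n (j, f)))).trans (mul_one _).le
    · refine (norm_sum_le _ _).trans (Finset.sum_le_sum fun i _ => ?_)
      rw [norm_mul]
      exact (mul_le_mul (he1 _ _ _) (hxB _ _) (norm_nonneg _) zero_le_one).trans (one_mul _).le
  · have h1 := hx n (j, f) hjf
    have hT : ∑ q, T n (j, f) q * x (n + 1) q =
        (e n j j)⁻¹ * ∑ h : Fin m → Fin k, t (n + 1) j h * ∏ s, e n (h s) (f s) := by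
      simp only [T, t, Fintype.sum_prod_type, ite_mul, zero_mul]
      rw [Finset.sum_eq_single j (fun i _ hi => by simp [hi]) (by simp), Finset.mul_sum]
      refine Finset.sum_congr rfl fun h _ => ?_
      rw [if_pos rfl]
      ring
    have hU : ∑ q, U n (j, f) q * x n q =
        -((e n j j)⁻¹ * ∑ i ∈ Finset.univ.erase j, e n j i * t n i f) := by
      simp only [U, t, Fintype.sum_prod_type_right, ite_mul, zero_mul]
      rw [Finset.sum_eq_single f (fun h _ hh => by simp [hh]) (by simp),
        ← Finset.add_sum_erase _ _ (Finset.mem_univ j), if_pos rfl, if_pos rfl, zero_add,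
        Finset.mul_sum, ← Finset.sum_neg_distrib]
      refine Finset.sum_congr rfl fun i hi => ?_
      rw [if_pos rfl, if_neg (Finset.ne_of_mem_erase hi)]
      ring
    rw [hT, hU] at h1
    simp only [g]
    rw [← Finset.add_sum_erase _ (fun i => e n j i * t n i f) (Finset.mem_univ j)]
    have h2 : e n j j * t n j f = e n j j * ((e n j j)⁻¹ * ∑ h : Fin m → Fin k,
        t (n + 1) j h * ∏ s, e n (h s) (f s) + -((e n j j)⁻¹ *
          ∑ i ∈ Finset.univ.erase j, e n j i * t n i f) + (e n j j)⁻¹ * c n j f) := by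
      rw [← h1]
    rw [h2]
    field_simp [hne n j]
    ring
  · rw [tensorMap_comp_clm, clm_comp_tensorMap]
    ext j
    simp only [PiLp.sub_apply, PiLp.add_apply, tensorMap_apply, g, sub_mul, add_mul,
      Finset.sum_add_distrib, Finset.sum_sub_distrib, he]

/-- One step of the construction of the normal form. -/
theorem ConjugatesUpTo.exists_succ {m : ℕ} (hm : 2 ≤ m) {A : ℕ → CSpace k →L[ℂ] CSpace k}
    {F : ℕ → CSpace k → CSpace k} {X P : ℕ → PolyMap k} {a θ CF : ℝ}
    (ha : 0 < a) (hθ : θ < 1) (hA : ∀ n, ‖A n‖ ≤ 1)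
    (htri : ∀ n, ∀ i j : Fin k, i < j → A n (EuclideanSpace.single j 1) i = 0)
    (hdiag : ∀ n j, a ≤ ‖A n (EuclideanSpace.single j 1) j‖)
    (hF : ∀ n, Differentiable ℂ (F n)) (hF1 : ∀ n z, ‖z‖ < 1 → ‖F n z‖ ≤ ‖z‖)
    (hFA : ∀ n z, ‖z‖ < 1 → ‖F n z - A n z‖ ≤ CF * ‖z‖ ^ 2)
    (S : Set (Fin k × (Fin m → Fin k)))
    (hS : ∀ n, ∀ p ∈ S, ‖∏ s, A n (EuclideanSpace.single (p.2 s) 1) (p.2 s)‖ ≤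
      θ * ‖A n (EuclideanSpace.single p.1 1) p.1‖)
    (h : ConjugatesUpTo A F X P m) :
    ∃ t g : ℕ → Fin k → (Fin m → Fin k) → ℂ, (∀ n j f, (j, f) ∈ S → g n j f = 0) ∧
      ConjugatesUpTo A F (fun n => X n + tensorPoly (t n)) (fun n => P n + tensorPoly (g n))
        (m + 1) := by
  obtain ⟨c, B, hcB, hc⟩ := h.exists_leading_tensor hF
  obtain ⟨t, g, N, htN, hgN, hg0, hhom⟩ := exists_solution_homological ha hθ hA htri hdiag hS hcB
  obtain ⟨C, hC, hest⟩ := h.estimate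
  refine ⟨t, g, hg0, h.bounded_left.add (boundedSeq_tensorPoly htN),
    h.bounded_right.add (boundedSeq_tensorPoly hgN), ?_⟩
  -- For `k = 0` there are no coefficients, and the bounds `B` and `N` could be negative.
  rcases isEmpty_or_nonempty (Fin k × (Fin m → Fin k)) with hemp | hnemp
  · have hk : IsEmpty (Fin k) := by
      by_contra hk
      obtain ⟨j⟩ := not_isEmpty_iff.1 hk
      exact hemp.false (j, fun _ => j)
    have : Subsingleton (CSpace k) := ⟨fun u v => by ext j; exact hk.elim j⟩
    refine ⟨0, le_rfl, fun n z _ => ?_⟩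
    simp [Subsingleton.elim _ (0 : CSpace k)]
  obtain ⟨j₀, f₀⟩ := hnemp
  have hN0 : 0 ≤ N := (norm_nonneg _).trans (htN 0 j₀ f₀)
  have hB0 : 0 ≤ B := (norm_nonneg _).trans (hcB 0 j₀ f₀)
  obtain ⟨K, hK⟩ : ∃ K : ℝ, K = k * k ^ m * m * N := ⟨_, rfl⟩
  have hK0 : 0 ≤ K := by rw [hK]; positivity
  have hm0 : m ≠ 0 := by omega
  obtain ⟨L, hL⟩ : ∃ L : ℝ, L = 1 + C + K := ⟨_, rfl⟩
  have hL1 : 1 ≤ L := by linarith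
  -- Both `X n` and its corrected version map the unit ball into the ball of radius `L`; the extra
  -- unit leaves room for Cauchy's estimate on `P n`.
  obtain ⟨M, hM0, hM⟩ := h.bounded_right.exists_norm_toMap_le_on_ball (L + 1)
  obtain ⟨Q, hQ⟩ : ∃ Q : ℝ, Q = 48 * M / (L + 1 - L) ^ 2 := ⟨_, rfl⟩
  have hQ0 : 0 ≤ Q := by rw [hQ]; positivity
  refine ⟨(C + K) + (B + K * |CF| + Q * L * K + K * L ^ (m - 1) * (C + K)), by positivity,
    fun n z hz => ?_⟩
  obtain ⟨h1, h2, h3⟩ := hest n z hz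
  have htz : ∀ n, ‖tensorMap (t n) z‖ ≤ K * ‖z‖ ^ m := fun n =>
    hK ▸ norm_tensorMap_le hm0 (htN n) z
  have hgz : ‖tensorMap (g n) z‖ ≤ K * ‖z‖ ^ m := hK ▸ norm_tensorMap_le hm0 (hgN n) z
  have hFn := hF1 n z hz
  have hAn : ‖A n z‖ ≤ ‖z‖ := ((A n).le_opNorm z).trans
    (mul_le_of_le_one_left (norm_nonneg z) (hA n))
  have hFAn : ‖F n z - A n z‖ ≤ |CF| * ‖z‖ ^ 2 := (hFA n z hz).trans
    (mul_le_mul_of_nonneg_right (le_abs_self CF) (by positivity))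
  have hcz := hc n z hz
  obtain ⟨x, hx⟩ : ∃ x, x = ‖z‖ := ⟨_, rfl⟩
  have hx0 : 0 ≤ x := hx ▸ norm_nonneg z
  rw [← hx] at hz h1 h2 h3 hgz hFn hAn hFAn hcz
  simp only [← hx] at htz
  have hxm2 : x ^ m ≤ x ^ 2 := pow_le_pow_of_le_one hx0 hz.le hm
  have hx21 : x ^ 2 ≤ x := by nlinarith
  have hKm : K * x ^ m ≤ K * x ^ 2 := by gcongr
  have hrest : 0 ≤ B + K * |CF| + Q * L * K + K * L ^ (m - 1) * (C + K) := by positivity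
  have hx2 : 0 ≤ x ^ 2 := by positivity
  have hxm : 0 ≤ x ^ m := by positivity
  have hxm1 : 0 ≤ x ^ (m + 1) := by positivity
  have hpow : x ^ (m - 1) * x ^ 2 = x ^ (m + 1) := by rw [← pow_add]; congr 1; omega
  simp only [PolyMap.toMap_add, toMap_tensorPoly, ← hx]
  refine ⟨?_, ?_, ?_⟩
  · calc ‖(X n).toMap z + tensorMap (t n) z - z‖
        = ‖((X n).toMap z - z) + tensorMap (t n) z‖ := by congr 1; abel
      _ ≤ C * x ^ 2 + K * x ^ m := (norm_add_le _ _).trans (add_le_add h1 (htz n))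
      _ ≤ (C + K) * x ^ 2 := by linarith
      _ ≤ _ := mul_le_mul_of_nonneg_right (le_add_of_nonneg_right hrest) hx2
  · calc ‖(P n).toMap z + tensorMap (g n) z - A n z‖
        = ‖((P n).toMap z - A n z) + tensorMap (g n) z‖ := by congr 1; abel
      _ ≤ C * x ^ 2 + K * x ^ m := (norm_add_le _ _).trans (add_le_add h2 hgz)
      _ ≤ (C + K) * x ^ 2 := by linarith
      _ ≤ _ := mul_le_mul_of_nonneg_right (le_add_of_nonneg_right hrest) hx2
  · have hw := htz n
    have hhz := hhom n z
    generalize (X n).toMap z = u at *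
    generalize tensorMap (t n) z = w at *
    have hCx : C * x ^ 2 ≤ C * x := mul_le_mul_of_nonneg_left hx21 hC
    have hKx : K * x ^ 2 ≤ K * x := mul_le_mul_of_nonneg_left hx21 hK0
    have hKx0 : 0 ≤ K * x := mul_nonneg hK0 hx0
    have hLeq : L * x = x + C * x + K * x := by rw [hL]; ring
    have huw : ‖u + w - z‖ ≤ (C + K) * x ^ 2 := by
      calc ‖u + w - z‖ = ‖(u - z) + w‖ := by congr 1; abel
        _ ≤ C * x ^ 2 + K * x ^ m := (norm_add_le _ _).trans (add_le_add h1 hw)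
        _ ≤ _ := by linarith
    have hun : ‖u‖ ≤ L * x := by
      have := norm_le_norm_add_norm_sub z u
      rw [norm_sub_rev, ← hx] at this
      linarith
    have huwn : ‖u + w‖ ≤ L * x := by
      have := norm_le_norm_add_norm_sub z (u + w)
      rw [norm_sub_rev, ← hx] at this
      linarith
    have hLx : L * x ≤ L := mul_le_of_le_one_right (by linarith) hz.le
    have e2 : ‖tensorMap (t (n + 1)) (F n z) - tensorMap (t (n + 1)) (A n z)‖ ≤
        K * |CF| * x ^ (m + 1) := by
      refine (norm_tensorMap_sub_le (htN (n + 1)) _ _).trans ?_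
      rw [← hK]
      calc K * max ‖F n z‖ ‖A n z‖ ^ (m - 1) * ‖F n z - A n z‖
          ≤ K * x ^ (m - 1) * (|CF| * x ^ 2) := by
            have h4 := max_le hFn hAn
            gcongr
        _ = _ := by rw [← hpow]; ring
    have e3 : ‖(P n).toMap (u + w) - (P n).toMap u - A n w‖ ≤ Q * L * K * x ^ (m + 1) := by
      have hd := (hasFDerivAt_zero_of_norm_sub_le_sq fun z hz => (hest n z hz).2.1).fderiv
      have := norm_sub_sub_fderiv_le_of_norm_le_on_larger_ball (f := (P n).toMap) (x := u)
        (y := u + w) (lt_add_one L) (P n).differentiable_toMap.differentiableOn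
        (fun z hz => hM n z (by simpa using (mem_ball.1 hz).le)) (hun.trans hLx) (huwn.trans hLx)
      rw [hd, add_sub_cancel_left, ← hQ] at this
      refine this.trans ?_
      calc Q * max ‖u‖ ‖u + w‖ * ‖w‖ ≤ Q * (L * x) * (K * x ^ m) := by
            have h4 := max_le hun huwn
            gcongr
        _ = _ := by ring
    have e4 : ‖tensorMap (g n) (u + w) - tensorMap (g n) z‖ ≤
        K * L ^ (m - 1) * (C + K) * x ^ (m + 1) := by
      refine (norm_tensorMap_sub_le (hgN n) _ _).trans ?_
      rw [← hK]
      calc K * max ‖u + w‖ ‖z‖ ^ (m - 1) * ‖u + w - z‖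
          ≤ K * (L * x) ^ (m - 1) * ((C + K) * x ^ 2) := by
            have h4 : max ‖u + w‖ ‖z‖ ≤ L * x :=
              max_le huwn (hx ▸ le_mul_of_one_le_left hx0 hL1)
            gcongr
        _ = _ := by rw [mul_pow, ← hpow]; ring
    -- The homological equation cancels all terms of degree `m`. The four remaining brackets are
    -- each of order `m + 1`: the Taylor remainder of the old defect, and the errors of replacing `F
    -- n` by `A n`, `P n` by its derivative, and `u + w` by `z`.
    have hid : (X (n + 1)).toMap (F n z) + tensorMap (t (n + 1)) (F n z) -
        ((P n).toMap (u + w) + tensorMap (g n) (u + w)) =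
        ((X (n + 1)).toMap (F n z) - (P n).toMap u - tensorMap (c n) z) +
        (tensorMap (t (n + 1)) (F n z) - tensorMap (t (n + 1)) (A n z)) -
        ((P n).toMap (u + w) - (P n).toMap u - A n w) -
        (tensorMap (g n) (u + w) - tensorMap (g n) z) := by
      rw [← hhz]
      abel
    rw [hid]
    calc _ ≤ B * x ^ (m + 1) + K * |CF| * x ^ (m + 1) + Q * L * K * x ^ (m + 1) +
          K * L ^ (m - 1) * (C + K) * x ^ (m + 1) :=
        (norm_sub_le _ _).trans (add_le_add ((norm_sub_le _ _).trans
          (add_le_add ((norm_add_le _ _).trans (add_le_add hcz e2)) e3)) e4)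
      _ ≤ _ := by
        have : 0 ≤ (C + K) * x ^ (m + 1) := by positivity
        linarith

end Homological

/-! ### The triangular normal form -/

section NormalForm

variable {k : ℕ}

theorem norm_sub_fderiv_zero_le {f : CSpace k → CSpace k} (hf : Differentiable ℂ f) {b : ℝ}
    (hb : ∀ z, ‖z‖ < 1 → ‖f z‖ ≤ b * ‖z‖) {z : CSpace k} (hz : ‖z‖ < 1) :
    ‖f z - fderiv ℂ f 0 z‖ ≤ 4 * b * ‖z‖ ^ 2 := by
  have h := norm_sub_iteratedFDeriv_le hf (m := 1) (C := b) (fun z hz => by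
    simpa using hb z (by simpa using hz)) (z := z) (by simpa using hz)
  simpa using h

theorem norm_fderiv_zero_le {f : CSpace k → CSpace k} {b : ℝ} (hb0 : 0 ≤ b)
    (hb : ∀ z, ‖z‖ < 1 → ‖f z‖ ≤ b * ‖z‖) : ‖fderiv ℂ f 0‖ ≤ b := by
  refine norm_fderiv_le_of_lip' ℂ hb0 ?_
  have h0 : f 0 = 0 := by simpa using hb 0 (by simp)
  filter_upwards [ball_mem_nhds (0 : CSpace k) one_pos] with z hz
  simpa [h0] using hb z (by simpa using hz)

/-- Apply the lower bound for `f` at `t • z`, divide by `t` and let `t → 0`; the quadratic error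
disappears. -/
theorem le_norm_fderiv_zero_apply {f : CSpace k → CSpace k} (hf : Differentiable ℂ f) {a b : ℝ}
    (ha : ∀ z, ‖z‖ < 1 → a * ‖z‖ ≤ ‖f z‖) (hb : ∀ z, ‖z‖ < 1 → ‖f z‖ ≤ b * ‖z‖)
    (z : CSpace k) : a * ‖z‖ ≤ ‖fderiv ℂ f 0 z‖ := by
  have h1 : Tendsto (fun t : ℝ => ‖fderiv ℂ f 0 z‖ + 4 * b * (t * ‖z‖ ^ 2)) (𝓝[>] 0)
      (𝓝 (‖fderiv ℂ f 0 z‖ + 4 * b * (0 * ‖z‖ ^ 2))) :=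
    (Continuous.tendsto (by fun_prop) 0).mono_left nhdsWithin_le_nhds
  rw [zero_mul, mul_zero, add_zero] at h1
  refine ge_of_tendsto h1 ?_
  have hpos : (0 : ℝ) < (‖z‖ + 1)⁻¹ := by positivity
  filter_upwards [Ioo_mem_nhdsGT hpos] with t ht
  have ht0 := ht.1
  have hn : ‖(t : ℂ) • z‖ = t * ‖z‖ := by
    rw [norm_smul, Complex.norm_real, Real.norm_of_nonneg ht0.le]
  have hlt : ‖(t : ℂ) • z‖ < 1 := by
    rw [hn]
    have := (lt_inv_comm₀ ht0 (by positivity)).1 ht.2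
    calc t * ‖z‖ < t * t⁻¹ := by
          apply mul_lt_mul_of_pos_left _ ht0
          linarith
      _ = 1 := mul_inv_cancel₀ ht0.ne'
  have h2 := norm_sub_fderiv_zero_le hf hb hlt
  have h3 := ha _ hlt
  have h4 := norm_le_norm_add_norm_sub (fderiv ℂ f 0 ((t : ℂ) • z)) (f ((t : ℂ) • z))
  rw [norm_sub_rev] at h4
  rw [map_smul, norm_smul, Complex.norm_real, Real.norm_of_nonneg ht0.le] at h4
  rw [map_smul] at h2
  rw [hn] at h2 h3
  have h5 : t * (a * ‖z‖) ≤ t * (‖fderiv ℂ f 0 z‖ + 4 * b * (t * ‖z‖ ^ 2)) := by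
    have : 4 * b * (t * ‖z‖) ^ 2 = t * (4 * b * (t * ‖z‖ ^ 2)) := by ring
    linarith
  exact le_of_mul_le_mul_left h5 ht0

/-- The diagonal entries of a lower triangular operator are eigenvalues. -/
theorem le_norm_diag_of_lowerTriangular {A : CSpace k →L[ℂ] CSpace k} {a : ℝ}
    (htri : ∀ i j : Fin k, i < j → A (EuclideanSpace.single j 1) i = 0)
    (ha : ∀ z, a * ‖z‖ ≤ ‖A z‖) (j : Fin k) : a ≤ ‖A (EuclideanSpace.single j 1) j‖ := by
  set c := A (EuclideanSpace.single j 1) j with hc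
  let M : Matrix (Fin k) (Fin k) ℂ :=
    Matrix.of (fun i l => A (EuclideanSpace.single l 1) i) - c • (1 : Matrix (Fin k) (Fin k) ℂ)
  have hM : ∀ i l, M i l = A (EuclideanSpace.single l 1) i - c * (1 : Matrix _ _ ℂ) i l :=
    fun i l => rfl
  have hdet : M.det = 0 := by
    rw [Matrix.det_of_isLowerTriangular M fun i l hil => ?_]
    · refine Finset.prod_eq_zero (Finset.mem_univ j) ?_
      rw [hM, Matrix.one_apply_eq, mul_one, ← hc, sub_self]
    · have hil' : i < l := hil
      rw [hM, Matrix.one_apply_ne hil'.ne, mul_zero, sub_zero, htri i l hil']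
  obtain ⟨v, hv0, hv⟩ := Matrix.exists_mulVec_eq_zero_iff.2 hdet
  have hz : A (WithLp.toLp 2 v) = c • (WithLp.toLp 2 v : CSpace k) := by
    ext i
    have h1 := congrFun hv i
    simp only [Matrix.mulVec, dotProduct, hM, sub_mul, Finset.sum_sub_distrib, Pi.zero_apply,
      Matrix.one_apply, mul_assoc, ite_mul, one_mul, zero_mul, mul_ite, mul_zero,
      Finset.sum_ite_eq, Finset.mem_univ, if_true] at h1
    rw [CSpace.clm_apply]
    simpa [sub_eq_zero] using h1
  have h2 := ha (WithLp.toLp 2 v)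
  rw [hz, norm_smul] at h2
  refine le_of_mul_le_mul_right h2 (norm_pos_iff.2 fun h0 => hv0 ?_)
  simpa using congrArg WithLp.ofLp h0

/-- Existence of a lower triangular normal form, together with conjugations up to any order. -/
theorem exists_triangular_normal_form {f : ℕ → CSpace k → CSpace k} {a b ξ : ℝ}
    (hf : ∀ n, Differentiable ℂ (f n)) (ha0 : 0 < a) (hb0 : 0 ≤ b) (hb1 : b < 1) (hξ : ξ < 1)
    (ha : ∀ n z, ‖z‖ < 1 → a * ‖z‖ ≤ ‖f n z‖) (hb : ∀ n z, ‖z‖ < 1 → ‖f n z‖ ≤ b * ‖z‖)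
    (htri : ∀ n, ∀ i j : Fin k, i < j → fderiv ℂ (f n) 0 (EuclideanSpace.single j 1) i = 0)
    (hres : ∀ n, ∀ i j l : Fin k, l ≤ j →
      ‖fderiv ℂ (f n) 0 (EuclideanSpace.single i 1) i‖ *
        ‖fderiv ℂ (f n) 0 (EuclideanSpace.single j 1) j‖ ≤
        ξ * ‖fderiv ℂ (f n) 0 (EuclideanSpace.single l 1) l‖) :
    ∃ P : ℕ → PolyMap k,
      (∀ n, (P n).IsTriangularWith fun j => fderiv ℂ (f n) 0 (EuclideanSpace.single j 1) j) ∧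
      ∀ N : ℕ, ∃ m ≥ N, ∃ X : ℕ → PolyMap k,
        ConjugatesUpTo (fun n => fderiv ℂ (f n) 0) f X P m := by
  set A : ℕ → CSpace k →L[ℂ] CSpace k := fun n => fderiv ℂ (f n) 0 with hA
  have hAb : ∀ n, ‖A n‖ ≤ b := fun n => norm_fderiv_zero_le hb0 (hb n)
  have hA1 : ∀ n, ‖A n‖ ≤ 1 := fun n => (hAb n).trans hb1.le
  have hfA : ∀ n z, ‖z‖ < 1 → ‖f n z - A n z‖ ≤ 4 * b * ‖z‖ ^ 2 := fun n z hz =>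
    norm_sub_fderiv_zero_le (hf n) (hb n) hz
  have hf1 : ∀ n z, ‖z‖ < 1 → ‖f n z‖ ≤ ‖z‖ := fun n z hz =>
    (hb n z hz).trans (mul_le_of_le_one_left (norm_nonneg z) hb1.le)
  have hdiag : ∀ n j, a ≤ ‖A n (EuclideanSpace.single j 1) j‖ := fun n j =>
    le_norm_diag_of_lowerTriangular (htri n) (le_norm_fderiv_zero_apply (hf n) (ha n) (hb n)) j
  have hdiagb : ∀ n j, ‖A n (EuclideanSpace.single j 1) j‖ ≤ b := fun n j =>
    (CSpace.norm_apply_le _ _).trans (((A n).le_opNorm _).trans (by simpa using hAb n))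
  have hlow : ∀ m ≥ 2, ∃ X P : ℕ → PolyMap k, ConjugatesUpTo A f X P m ∧
      ∀ n, (P n).IsTriangularWith fun j => A n (EuclideanSpace.single j 1) j := by
    intro m hm
    induction m, hm using Nat.le_induction with
    | base => exact ⟨_, _, conjugatesUpTo_two hA1 hfA, fun n => PolyMap.isTriangularWith_linear (htri n)⟩
    | succ m hm ih =>
      obtain ⟨X, P, h, hP⟩ := ih
      obtain ⟨t, g, hg, h'⟩ := h.exists_succ hm ha0 hξ hA1 htri hdiag hf hf1 hfA
        -- These are the non-triangular monomials. As `m ≥ 2`, another slot `s'` exists; condition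
        -- (iii) applies to the pair and the other factors are at most one.
        {p | ∃ s, p.1 ≤ p.2 s} (by
          rintro n ⟨j, φ⟩ ⟨s, hs⟩
          simp only at hs ⊢
          have hex : ∃ s' : Fin m, s' ≠ s := by
            have : Nontrivial (Fin m) := Fin.nontrivial_iff_two_le.2 hm
            exact exists_ne s
          obtain ⟨s', hs'⟩ := hex
          rw [norm_prod]
          calc ∏ i, ‖A n (EuclideanSpace.single (φ i) 1) (φ i)‖
              ≤ ∏ i ∈ {s', s}, ‖A n (EuclideanSpace.single (φ i) 1) (φ i)‖ :=
                Finset.prod_le_prod_of_subset_of_le_one (Finset.subset_univ _)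
                  (fun _ _ => norm_nonneg _) fun i _ _ => (hdiagb n _).trans hb1.le
            _ ≤ _ := by
                rw [Finset.prod_pair hs']
                exact hres n (φ s') (φ s) j hs)
      exact ⟨_, _, h', fun n => (hP n).add_tensorPoly fun j φ hjφ => hg n j φ hjφ⟩
  -- From degree `D` on, `∏ ‖λ_{f s}‖ ≤ b ^ m ≤ a / 2 ≤ ‖λ_j‖ / 2`, so every monomial can be
  -- removed. `P` is frozen here and only `X` is refined further.
  obtain ⟨D, hD⟩ := exists_pow_lt_of_lt_one (half_pos ha0) hb1
  obtain ⟨X₀, P, h₀, hP⟩ := hlow (max D 2) (le_max_right _ _)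
  have hhigh : ∀ m ≥ max D 2, ∃ X : ℕ → PolyMap k, ConjugatesUpTo A f X P m := by
    intro m hm
    induction m, hm using Nat.le_induction with
    | base => exact ⟨X₀, h₀⟩
    | succ m hm ih =>
      obtain ⟨X, h⟩ := ih
      obtain ⟨t, g, hg, h'⟩ := h.exists_succ ((le_max_right _ _).trans hm) (θ := 1 / 2) ha0
        (by norm_num) hA1 htri hdiag hf hf1 hfA Set.univ (by
          rintro n ⟨j, φ⟩ -
          rw [norm_prod]
          calc ∏ i, ‖A n (EuclideanSpace.single (φ i) 1) (φ i)‖ ≤ ∏ _i : Fin m, b :=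
                Finset.prod_le_prod (fun _ _ => norm_nonneg _) fun i _ => hdiagb n _
            _ = b ^ m := by simp
            _ ≤ b ^ D := pow_le_pow_of_le_one hb0 hb1.le ((le_max_left _ _).trans hm)
            _ ≤ 1 / 2 * a := by linarith
            _ ≤ _ := by
              have := hdiag n j
              gcongr)
      have hg0 : ∀ n, P n + tensorPoly (g n) = P n := fun n => by
        funext j
        have : ∀ φ, g n j φ = 0 := fun φ => hg n j φ trivial
        simp [tensorPoly, this]
      simp only [hg0] at h'
      exact ⟨_, h'⟩
  exact ⟨P, hP, fun N => ⟨max N (max D 2), le_max_left _ _, hhigh _ (le_max_right _ _)⟩⟩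

end NormalForm

/-! ### Dynamics of triangular families -/

section TriangularFamilies

variable {k : ℕ}

/-- A family of entire maps `g_n(z)_j = c_{n,j} z_j + r_{n,j}(z_1, …, z_{j-1})` of uniform
polynomial growth with attracting, uniformly invertible diagonal. -/
structure TriangularFamily (g : ℕ → CSpace k → CSpace k) (c : ℕ → Fin k → ℂ) (a b C : ℝ)
    (d : ℕ) : Prop where
  differentiable : ∀ n, Differentiable ℂ (g n)
  map_zero : ∀ n, g n 0 = 0
  rem_congr : ∀ n (j : Fin k) z w, (∀ i < j, z i = w i) →
    g n z j - c n j * z j = g n w j - c n j * w j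
  pos : 0 < a
  lt_one : b < 1
  le_diag : ∀ n j, a ≤ ‖c n j‖
  diag_le : ∀ n j, ‖c n j‖ ≤ b
  nonneg : 0 ≤ C
  growth : ∀ n z, ‖g n z‖ ≤ C * (1 + ‖z‖) ^ d

namespace TriangularFamily

variable {g : ℕ → CSpace k → CSpace k} {c : ℕ → Fin k → ℂ} {a b C : ℝ} {d : ℕ}

theorem diag_ne_zero (h : TriangularFamily g c a b C d) (n : ℕ) (j : Fin k) : c n j ≠ 0 :=
  norm_pos_iff.1 (h.pos.trans_le (h.le_diag n j))

theorem exists_norm_rem_sub_le (h : TriangularFamily g c a b C d) :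
    ∃ C' : ℝ, 0 ≤ C' ∧ ∀ n (j : Fin k) (z w : CSpace k) (R δ : ℝ), 0 ≤ R → 0 ≤ δ →
      (∀ i < j, ‖z i‖ ≤ R ∧ ‖w i‖ ≤ R ∧ ‖z i - w i‖ ≤ δ) →
      ‖(g n z j - c n j * z j) - (g n w j - c n j * w j)‖ ≤ C' * (1 + R) ^ (d + 1) * δ := by
  have hC := h.nonneg
  refine ⟨2 * ((C + 1) * (2 + k) ^ (d + 1)) * k, by positivity,
    fun n j z w R δ hR hδ hzw => ?_⟩
  have hb0 : 0 ≤ b := (norm_nonneg _).trans (h.diag_le n j)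
  -- Truncation leaves the remainder unchanged, so Cauchy's estimate depends only on the earlier
  -- coordinates. The exponent `d + 1` absorbs the linear term.
  let τ : CSpace k → CSpace k := fun z => WithLp.toLp 2 fun i => if i < j then z i else 0
  have hτ : ∀ (z : CSpace k) i, τ z i = if i < j then z i else 0 := fun _ _ => rfl
  have hτe : ∀ z, g n z j - c n j * z j = g n (τ z) j - c n j * τ z j := fun z =>
    h.rem_congr n j _ _ fun i hi => by rw [hτ, if_pos hi]
  have hz : ‖τ z‖ ≤ k * R := CSpace.norm_le_of_forall fun i => by
    rw [hτ]; split_ifs with hi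
    · exact (hzw i hi).1
    · simpa using hR
  have hw : ‖τ w‖ ≤ k * R := CSpace.norm_le_of_forall fun i => by
    rw [hτ]; split_ifs with hi
    · exact (hzw i hi).2.1
    · simpa using hR
  have hzw' : ‖τ z - τ w‖ ≤ k * δ := CSpace.norm_le_of_forall fun i => by
    rw [PiLp.sub_apply, hτ, hτ]; split_ifs with hi
    · exact (hzw i hi).2.2
    · simpa using hδ
  have hkR : 0 ≤ k * R := by positivity
  have hM : ∀ x ∈ ball (0 : CSpace k) (k * R + 1),
      ‖g n x j - c n j * x j‖ ≤ (C + 1) * (2 + k * R) ^ (d + 1) := by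
    intro x hx
    have hx' : ‖x‖ ≤ k * R + 1 := by simpa using (mem_ball.1 hx).le
    have h1 : ‖g n x j‖ ≤ C * (2 + k * R) ^ d := by
      refine (CSpace.norm_apply_le _ _).trans ((h.growth n x).trans ?_)
      have : 1 + ‖x‖ ≤ 2 + k * R := by linarith
      gcongr
    have h2 : ‖c n j * x j‖ ≤ 2 + k * R := by
      rw [norm_mul]
      have h3 : ‖c n j‖ ≤ 1 := (h.diag_le n j).trans h.lt_one.le
      have h4 := CSpace.norm_apply_le x j
      nlinarith [norm_nonneg (x j), norm_nonneg (c n j)]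
    have h5 : (1 : ℝ) ≤ (2 + k * R) ^ d := one_le_pow₀ (by linarith)
    have h6 : 0 ≤ C * (2 + k * R) ^ d := by positivity
    calc _ ≤ C * (2 + k * R) ^ d + (2 + k * R) := (norm_sub_le _ _).trans (add_le_add h1 h2)
      _ ≤ C * (2 + k * R) ^ d * (2 + k * R) + (2 + k * R) ^ d * (2 + k * R) := by
          refine add_le_add (le_mul_of_one_le_right h6 (by linarith))
            (le_mul_of_one_le_left (by linarith) h5)
      _ = _ := by ring
  have hd : Differentiable ℂ fun x : CSpace k => g n x j - c n j * x j := by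
    have := CSpace.differentiable_iff.1 (h.differentiable n) j
    exact this.sub (by fun_prop)
  have key := norm_sub_le_of_norm_le_on_larger_ball (lt_add_one (k * R)) hd.differentiableOn hM
    (x := τ w) (y := τ z) (by simpa using hw) (by simpa using hz)
  rw [hτe z, hτe w]
  refine key.trans ?_
  rw [add_sub_cancel_left, div_one]
  have h7 : 2 + k * R ≤ (2 + k) * (1 + R) := by nlinarith [Nat.cast_nonneg (α := ℝ) k]
  calc 2 * ((C + 1) * (2 + k * R) ^ (d + 1)) * ‖τ z - τ w‖
      ≤ 2 * ((C + 1) * ((2 + k) * (1 + R)) ^ (d + 1)) * (k * δ) := by gcongr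
    _ = _ := by rw [mul_pow]; ring

theorem injective (h : TriangularFamily g c a b C d) (n : ℕ) : Function.Injective (g n) := by
  intro z w hzw
  have : ∀ j, z j = w j := by
    intro j
    induction j using WellFoundedLT.induction with
    | ind j ih =>
      have h1 := h.rem_congr n j z w ih
      rw [hzw, sub_right_inj] at h1
      exact mul_left_cancel₀ (h.diag_ne_zero n j) h1
  ext j
  exact this j

/-- The fixed point iteration which solves `g_n(z) = w` after `k` steps. -/
noncomputable def solveStep (g : ℕ → CSpace k → CSpace k) (c : ℕ → Fin k → ℂ) (n : ℕ) (w z : CSpace k) :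
    CSpace k :=
  WithLp.toLp 2 fun j => (w j - (g n z j - c n j * z j)) / c n j

theorem solveStep_apply (n : ℕ) (w z : CSpace k) (j : Fin k) :
    solveStep g c n w z j = (w j - (g n z j - c n j * z j)) / c n j := rfl

/-- Each step computes coordinate `j` from the earlier ones alone, so one more coordinate becomes
stationary each time; the iteration is a finite back substitution. -/
theorem solveStep_iterate_congr (h : TriangularFamily g c a b C d) (n : ℕ) (w : CSpace k) (i : ℕ)
    (j : Fin k) (hj : j.val < i) :
    (solveStep g c n w)^[i + 1] 0 j = (solveStep g c n w)^[i] 0 j := by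
  induction i generalizing j with
  | zero => omega
  | succ i ih =>
    have e := h.rem_congr n j ((solveStep g c n w)^[i + 1] 0) ((solveStep g c n w)^[i] 0)
      fun l hl => ih l (by have : l.val < j.val := hl; omega)
    rw [Function.iterate_succ_apply' _ (i + 1), solveStep_apply, e,
      Function.iterate_succ_apply' _ i, solveStep_apply]

/-- The inverse of a member of a triangular family. -/
noncomputable def inverse (g : ℕ → CSpace k → CSpace k) (c : ℕ → Fin k → ℂ) (n : ℕ) (w : CSpace k) : CSpace k :=
  (solveStep g c n w)^[k] 0

theorem apply_inverse (h : TriangularFamily g c a b C d) (n : ℕ) (w : CSpace k) :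
    g n (inverse g c n w) = w := by
  ext j
  have h1 := h.solveStep_iterate_congr n w k j j.2
  rw [Function.iterate_succ_apply', solveStep_apply, div_eq_iff (h.diag_ne_zero n j)] at h1
  unfold inverse
  linear_combination -h1

theorem differentiable_inverse (h : TriangularFamily g c a b C d) (n : ℕ) :
    Differentiable ℂ (inverse g c n) := by
  have : ∀ i, Differentiable ℂ fun w => (solveStep g c n w)^[i] 0 := by
    intro i
    induction i with
    | zero => simp
    | succ i ih =>
      simp only [Function.iterate_succ_apply']
      rw [CSpace.differentiable_iff]
      intro j
      simp only [solveStep_apply]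
      have h1 := CSpace.differentiable_iff.1 ih j
      have h2 := CSpace.differentiable_iff.1 ((h.differentiable n).comp ih) j
      have h3 : Differentiable ℂ fun w : CSpace k => w j := by fun_prop
      simp only [div_eq_mul_inv]
      exact Differentiable.mul_const (h3.sub (h2.sub (h1.const_mul (c n j)))) _
  exact this k

/-- The members of a triangular family are automorphisms. -/
noncomputable def toAut (h : TriangularFamily g c a b C d) (n : ℕ) : Aut0 k where
  toFun := g n
  invFun := inverse g c n
  left_inv z := h.injective n (h.apply_inverse n (g n z))
  right_inv w := h.apply_inverse n w
  differentiable_toFun := h.differentiable n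
  differentiable_invFun := h.differentiable_inverse n
  map_zero' := h.map_zero n

end TriangularFamily

namespace Aut0

theorem compFirst_succ_apply (F : ℕ → Aut0 k) (n : ℕ) (z : CSpace k) :
    compFirst F (n + 1) z = (F n).toFun (compFirst F n z) := rfl

theorem compFirst_succ_symm_apply (F : ℕ → Aut0 k) (n : ℕ) (z : CSpace k) :
    (compFirst F (n + 1)).symm z = (compFirst F n).symm ((F n).invFun z) := rfl

theorem compFirst_add (F : ℕ → Aut0 k) (p n : ℕ) :
    compFirst F (p + n) = (compFirst F p).trans (compFirst (fun i => F (p + i)) n) := by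
  induction n with
  | zero => rfl
  | succ n ih =>
    ext1 z
    rw [← add_assoc, compFirst_succ_apply, ih]
    rfl

theorem compFirst_map_zero (F : ℕ → Aut0 k) (n : ℕ) : compFirst F n 0 = 0 := by
  induction n with
  | zero => rfl
  | succ n ih => rw [compFirst_succ_apply, ih, (F n).map_zero']

theorem compFirst_symm_map_zero (F : ℕ → Aut0 k) (n : ℕ) : (compFirst F n).symm 0 = 0 := by
  rw [Equiv.symm_apply_eq, compFirst_map_zero]

theorem differentiable_compFirst (F : ℕ → Aut0 k) (n : ℕ) : Differentiable ℂ (compFirst F n) := by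
  induction n with
  | zero => exact differentiable_id
  | succ n ih => exact (F n).differentiable_toFun.comp ih

theorem differentiable_compFirst_symm (F : ℕ → Aut0 k) (n : ℕ) :
    Differentiable ℂ (compFirst F n).symm := by
  induction n with
  | zero => exact differentiable_id
  | succ n ih => exact ih.comp (F n).differentiable_invFun

end Aut0

/-- Once the forcing is below `η / 2 * (1 - b)`, the affine recurrence contracts towards its fixed
point `η / 2`. -/
theorem tendsto_zero_of_le_mul_add {x ε : ℕ → ℝ} {b : ℝ} (hx : ∀ n, 0 ≤ x n) (hb1 : b < 1)
    (hb0 : 0 ≤ b) (hε : Tendsto ε atTop (𝓝 0)) (h : ∀ n, x (n + 1) ≤ b * x n + ε n) :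
    Tendsto x atTop (𝓝 0) := by
  rw [Metric.tendsto_atTop]
  intro η hη
  have h1 : 0 < 1 - b := sub_pos.2 hb1
  obtain ⟨N, hN⟩ := eventually_atTop.1 (hε.eventually (gt_mem_nhds
    (by positivity : 0 < η / 2 * (1 - b))))
  have key : ∀ m, x (N + m) ≤ b ^ m * x N + η / 2 := by
    intro m
    induction m with
    | zero => simp; positivity
    | succ m ih =>
      have h2 := h (N + m)
      have h3 := hN (N + m) (by omega)
      rw [← add_assoc]
      calc x (N + m + 1) ≤ b * x (N + m) + ε (N + m) := h2
        _ ≤ b * (b ^ m * x N + η / 2) + η / 2 * (1 - b) := by gcongr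
        _ = _ := by ring
  have h4 : Tendsto (fun m => b ^ m * x N) atTop (𝓝 (0 * x N)) :=
    (tendsto_pow_atTop_nhds_zero_of_lt_one hb0 hb1).mul_const _
  rw [zero_mul] at h4
  obtain ⟨M, hM⟩ := eventually_atTop.1 (h4.eventually (gt_mem_nhds (half_pos hη)))
  refine ⟨N + M, fun n hn => ?_⟩
  obtain ⟨m, rfl⟩ := Nat.exists_eq_add_of_le (show N ≤ n by omega)
  have h5 := hM m (by omega)
  have h6 := key m
  rw [Real.dist_eq, sub_zero, abs_of_nonneg (hx _)]
  linarith

namespace TriangularFamily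

variable {c : ℕ → Fin k → ℂ} {a b C : ℝ} {d : ℕ} {G : ℕ → Aut0 k}

/-- Every point is attracted to the origin by a triangular family. -/
theorem tendsto_compFirst (h : TriangularFamily (fun n => (G n).toFun) c a b C d)
    (w : CSpace k) : Tendsto (fun n => Aut0.compFirst G n w) atTop (𝓝 0) := by
  obtain ⟨C', hC', hrem⟩ := h.exists_norm_rem_sub_le
  -- Induction on the coordinate: the `j`-th one contracts by `b`, up to a forcing controlled by the
  -- earlier coordinates, which already tend to zero.
  have hcoord : ∀ j : Fin k, Tendsto (fun n => ‖Aut0.compFirst G n w j‖) atTop (𝓝 0) := by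
    intro j
    induction j using WellFoundedLT.induction with
    | ind j ih =>
      let δ : ℕ → ℝ := fun n => ∑ i ∈ Finset.univ.filter (· < j), ‖Aut0.compFirst G n w i‖
      have hδ0 : ∀ n, 0 ≤ δ n := fun n => Finset.sum_nonneg fun _ _ => norm_nonneg _
      have hδ : Tendsto δ atTop (𝓝 0) := by
        rw [← Finset.sum_const_zero (s := Finset.univ.filter (· < j))]
        exact tendsto_finsetSum _ fun i hi => ih i (Finset.mem_filter.1 hi).2
      have hε : Tendsto (fun n => C' * (1 + δ n) ^ (d + 1) * δ n) atTop (𝓝 0) := by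
        have := (((hδ.const_add 1).pow (d + 1)).const_mul C').mul hδ
        simpa using this
      refine tendsto_zero_of_le_mul_add (fun n => norm_nonneg _) h.lt_one
        ((norm_nonneg _).trans (h.diag_le 0 j)) hε fun n => ?_
      have h1 := hrem n j (Aut0.compFirst G n w) 0 (δ n) (δ n) (hδ0 n) (hδ0 n) fun i hi => by
        have : ‖Aut0.compFirst G n w i‖ ≤ δ n :=
          Finset.single_le_sum (f := fun i => ‖Aut0.compFirst G n w i‖)
            (fun _ _ => norm_nonneg _) (Finset.mem_filter.2 ⟨Finset.mem_univ i, hi⟩)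
        exact ⟨this, by simpa using hδ0 n, by simpa using this⟩
      rw [(G n).map_zero'] at h1
      simp only [PiLp.zero_apply, mul_zero, sub_zero] at h1
      rw [Aut0.compFirst_succ_apply]
      set z := Aut0.compFirst G n w
      calc ‖(G n).toFun z j‖ = ‖c n j * z j + ((G n).toFun z j - c n j * z j)‖ := by
            congr 1; ring
        _ ≤ ‖c n j‖ * ‖z j‖ + ‖(G n).toFun z j - c n j * z j‖ := by
            rw [← norm_mul]; exact norm_add_le _ _
        _ ≤ _ := add_le_add (mul_le_mul_of_nonneg_right (h.diag_le n j) (norm_nonneg _)) h1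
  have hsum : Tendsto (fun n => ∑ j, ‖Aut0.compFirst G n w j‖) atTop (𝓝 0) := by
    rw [← Finset.sum_const_zero (s := (Finset.univ : Finset (Fin k)))]
    exact tendsto_finsetSum _ fun j _ => hcoord j
  exact squeeze_zero_norm (fun n => CSpace.norm_le_sum _) hsum

/-- The inverses of the compositions of a triangular family grow at most exponentially. -/
theorem exists_norm_compFirst_symm_sub_le
    (h : TriangularFamily (fun n => (G n).toFun) c a b C d) :
    ∃ K : ℝ, 1 ≤ K ∧ ∀ n p u v, ‖u‖ ≤ 1 → ‖v‖ ≤ 1 →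
      ‖(Aut0.compFirst (fun i => G (p + i)) n).symm u -
        (Aut0.compFirst (fun i => G (p + i)) n).symm v‖ ≤ k * K ^ n * ‖u - v‖ := by
  obtain ⟨C', hC', hrem⟩ := h.exists_norm_rem_sub_le
  let Φ : ℕ → ℕ → CSpace k → CSpace k := fun p n => (Aut0.compFirst (fun i => G (p + i)) n).symm
  have hΦ0 : ∀ p n, Φ p n 0 = 0 := fun p n => Aut0.compFirst_symm_map_zero _ n
  -- Peeling off the earliest map gives a recurrence for the inverses; it shifts `p`, so all bounds
  -- must be uniform in `p`.
  have hΦs : ∀ p n u, (G p).toFun (Φ p (n + 1) u) = Φ (p + 1) n u := by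
    intro p n u
    have h1 : Aut0.compFirst (fun i => G (p + i)) (n + 1) =
        (G p).toEquiv.trans (Aut0.compFirst (fun i => G (p + 1 + i)) n) := by
      rw [add_comm n 1, Aut0.compFirst_add]
      simp only [add_assoc]
      rfl
    simp only [Φ, h1]
    exact (G p).toEquiv.apply_symm_apply _
  have ha := h.pos
  have key : ∀ J : ℕ, ∃ K : ℝ, 1 ≤ K ∧ ∀ j : Fin k, j.val < J → ∀ n p u v, ‖u‖ ≤ 1 → ‖v‖ ≤ 1 →
      ‖Φ p n u j - Φ p n v j‖ ≤ K ^ n * ‖u - v‖ := by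
    intro J
    induction J with
    | zero => exact ⟨1, le_rfl, fun j hj => absurd hj (by omega)⟩
    | succ J ih =>
      obtain ⟨K, hK, hKJ⟩ := ih
      have hK0 : 0 ≤ K := by linarith
      -- The earlier coordinates contribute a forcing of size `(K ^ (n + 1)) ^ (d + 2)`, still
      -- exponential in `n` with base `L`. The constant `Q` then pays for dividing by the diagonal,
      -- and the growth base is raised once per coordinate.
      obtain ⟨L, hL⟩ : ∃ L, L = K ^ (d + 2) := ⟨_, rfl⟩
      have hKL : K ≤ L := hL ▸ le_self_pow₀ hK (by omega)
      have hL0 : 0 ≤ L := hK0.trans hKL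
      obtain ⟨Q, hQ⟩ : ∃ Q, Q = a⁻¹ * (1 + C' * 2 ^ (d + 1) * L) := ⟨_, rfl⟩
      have hQ0 : 0 ≤ Q := by rw [hQ]; positivity
      refine ⟨L + Q, by linarith, fun j hj => ?_⟩
      rcases Nat.lt_succ_iff_lt_or_eq.1 hj with hj' | hj'
      · intro n p u v hu hv
        refine (hKJ j hj' n p u v hu hv).trans ?_
        have : K ≤ L + Q := by linarith
        gcongr
      · intro n
        induction n with
        | zero =>
          intro p u v _ _
          rw [pow_zero, one_mul]
          exact CSpace.norm_apply_le (u - v) j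
        | succ n ihn =>
          intro p u v hu hv
          have h0 : ∀ u : CSpace k, ‖u‖ ≤ 1 → ∀ i < j, ‖Φ p (n + 1) u i‖ ≤ K ^ (n + 1) :=
            fun u hu i hi => by
              have h1 := hKJ i (by have : i.val < j.val := hi; omega) (n + 1) p u 0 hu (by simp)
              rw [hΦ0, PiLp.zero_apply, sub_zero, sub_zero] at h1
              exact h1.trans (mul_le_of_le_one_right (by positivity) hu)
          have h1 := hrem p j (Φ p (n + 1) u) (Φ p (n + 1) v) (K ^ (n + 1))
            (K ^ (n + 1) * ‖u - v‖) (by positivity) (by positivity) fun i hi =>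
              ⟨h0 u hu i hi, h0 v hv i hi,
                hKJ i (by have : i.val < j.val := hi; omega) (n + 1) p u v hu hv⟩
          simp only [hΦs] at h1
          have h2 := ihn (p + 1) u v hu hv
          generalize Φ (p + 1) n u = y at h1 h2
          generalize Φ (p + 1) n v = y' at h1 h2
          generalize Φ p (n + 1) u = z at h1 ⊢
          generalize Φ p (n + 1) v = z' at h1 ⊢
          have h3 : c p j * (z j - z' j) =
              (y j - y' j) - ((y j - c p j * z j) - (y' j - c p j * z' j)) := by ring
          have h4 : a * ‖z j - z' j‖ ≤ (L + Q) ^ n * ‖u - v‖ +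
              C' * (1 + K ^ (n + 1)) ^ (d + 1) * (K ^ (n + 1) * ‖u - v‖) := by
            calc a * ‖z j - z' j‖ ≤ ‖c p j‖ * ‖z j - z' j‖ :=
                  mul_le_mul_of_nonneg_right (h.le_diag p j) (norm_nonneg _)
              _ = ‖c p j * (z j - z' j)‖ := (norm_mul _ _).symm
              _ ≤ _ := by
                  rw [h3]
                  exact (norm_sub_le _ _).trans (add_le_add h2 h1)
          have h5 : (1 + K ^ (n + 1)) ^ (d + 1) * K ^ (n + 1) ≤ 2 ^ (d + 1) * (L * (L + Q) ^ n) := by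
            have h6 : (1 : ℝ) ≤ K ^ (n + 1) := one_le_pow₀ hK
            calc (1 + K ^ (n + 1)) ^ (d + 1) * K ^ (n + 1)
                ≤ (2 * K ^ (n + 1)) ^ (d + 1) * K ^ (n + 1) := by
                  have : 1 + K ^ (n + 1) ≤ 2 * K ^ (n + 1) := by linarith
                  gcongr
              _ = 2 ^ (d + 1) * (L * L ^ n) := by rw [hL]; ring
              _ ≤ _ := by
                  have : L ≤ L + Q := by linarith
                  gcongr
          have h7 : ‖z j - z' j‖ ≤ Q * (L + Q) ^ n * ‖u - v‖ := by
            refine le_of_mul_le_mul_left (a := a) (h4.trans ?_) ha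
            have hQa : a * Q = 1 + C' * 2 ^ (d + 1) * L := by rw [hQ, mul_inv_cancel_left₀ ha.ne']
            calc _ = ((L + Q) ^ n + C' * ((1 + K ^ (n + 1)) ^ (d + 1) * K ^ (n + 1))) * ‖u - v‖ := by
                  ring
              _ ≤ ((L + Q) ^ n + C' * (2 ^ (d + 1) * (L * (L + Q) ^ n))) * ‖u - v‖ := by gcongr
              _ = _ := by linear_combination (-((L + Q) ^ n * ‖u - v‖)) * hQa
          refine h7.trans ?_
          rw [pow_succ, mul_comm ((L + Q) ^ n)]
          have : Q ≤ L + Q := by linarith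
          gcongr
  obtain ⟨K, hK, hKk⟩ := key k
  refine ⟨K, hK, fun n p u v hu hv => ?_⟩
  refine (CSpace.norm_le_of_forall fun j => hKk j j.2 n p u v hu hv).trans (le_of_eq ?_)
  ring

end TriangularFamily

end TriangularFamilies

/-! ### A quantitative inverse function theorem near the identity -/

section NearIdentity

variable {k : ℕ}

/-- A holomorphic map tangent to the identity is biholomorphic near the origin, on balls
which depend only on the second order bound. -/
theorem exists_openPartialHomeomorph_of_near_id {ψ : CSpace k → CSpace k} {r ρ C : ℝ}
    (hC : 0 ≤ C) (hρ : 0 < ρ) (hρr : 2 * ρ ≤ r) (hρC : 16 * C * ρ ≤ 1)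
    (hd : DifferentiableOn ℂ ψ (ball 0 r))
    (hψ : ∀ z ∈ ball (0 : CSpace k) r, ‖ψ z - z‖ ≤ C * ‖z‖ ^ 2) :
    ∃ e : OpenPartialHomeomorph (CSpace k) (CSpace k), ⇑e = ψ ∧ e.source = ball 0 ρ ∧
      ball 0 (ρ / 4) ⊆ e.target ∧ ∀ w ∈ e.target, DifferentiableAt ℂ e.symm w := by
  have hsub2 : ball (0 : CSpace k) (2 * ρ) ⊆ ball 0 r := ball_subset_ball hρr
  have hsub1 : ball (0 : CSpace k) ρ ⊆ ball 0 r := (ball_subset_ball (by linarith)).trans hsub2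
  -- On the ball of radius `2 * ρ` the map `ψ - id` is at most `4 * C * ρ ^ 2`, so Cauchy gives the
  -- Lipschitz constant `8 * C * ρ ≤ 1 / 2` on the ball of radius `ρ`.
  have hlip : ∀ x ∈ ball (0 : CSpace k) ρ, ∀ y ∈ ball (0 : CSpace k) ρ,
      ‖(ψ y - y) - (ψ x - x)‖ ≤ 1 / 2 * ‖y - x‖ := by
    intro x hx y hy
    have h := norm_sub_le_of_norm_le_on_larger_ball (f := fun z => ψ z - z) (c := 0) (r := ρ)
      (R := 2 * ρ) (M := C * (2 * ρ) ^ 2) (by linarith)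
      ((hd.mono hsub2).sub differentiableOn_id) (fun z hz => (hψ z (hsub2 hz)).trans (by
        have : ‖z‖ ≤ 2 * ρ := by simpa using (mem_ball.1 hz).le
        gcongr)) (ball_subset_closedBall hx) (ball_subset_closedBall hy)
    refine h.trans ?_
    have h2 : 2 * (C * (2 * ρ) ^ 2) / (2 * ρ - ρ) = 16 * C * ρ / 2 := by
      rw [show 2 * ρ - ρ = ρ by ring]; field_simp; ring
    rw [h2]
    gcongr
  have hψ0 : ψ 0 = 0 := by simpa using hψ 0 (by simp; linarith)
  let f' : CSpace k ≃L[ℂ] CSpace k := ContinuousLinearEquiv.refl ℂ (CSpace k)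
  have hA : ApproximatesLinearOn ψ (f' : CSpace k →L[ℂ] CSpace k) (ball 0 ρ) (1 / 2) := by
    intro x hx y hy
    have h := hlip y hy x hx
    have e : ψ x - ψ y - (f' : CSpace k →L[ℂ] CSpace k) (x - y) = (ψ x - x) - (ψ y - y) := by
      simp only [f', ContinuousLinearEquiv.coe_refl, ContinuousLinearMap.id_apply]
      abel
    rw [e]
    simpa using h
  have hN : Nontrivial (CSpace k) →
      ‖(f'.symm : CSpace k →L[ℂ] CSpace k)‖₊ = 1 := fun _ => by
    have : (f'.symm : CSpace k →L[ℂ] CSpace k) = ContinuousLinearMap.id ℂ (CSpace k) := rfl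
    rw [this]
    exact NNReal.eq ContinuousLinearMap.norm_id
  have hc : Subsingleton (CSpace k) ∨
      (1 / 2 : NNReal) < ‖(f'.symm : CSpace k →L[ℂ] CSpace k)‖₊⁻¹ := by
    rcases subsingleton_or_nontrivial (CSpace k) with h | h
    · exact Or.inl h
    · right
      rw [hN h, inv_one]
      exact NNReal.half_lt_self one_ne_zero
  let e := hA.toOpenPartialHomeomorph ψ (ball 0 ρ) hc isOpen_ball
  have he : ⇑e = ψ := rfl
  have hes : e.source = ball 0 ρ := rfl
  have h0t : (0 : CSpace k) ∈ e.target := by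
    have := e.map_source (x := 0) (by rw [hes]; exact mem_ball_self hρ)
    rwa [he, hψ0] at this
  refine ⟨e, he, hes, ?_, fun w hw => ?_⟩
  · rcases subsingleton_or_nontrivial (CSpace k) with h | h
    · intro w _
      rwa [Subsingleton.elim w 0]
    -- The image contains a ball of radius `(1 - 1 / 2) * (ρ / 2) = ρ / 4`.
    · have := hA.closedBall_subset_target hc isOpen_ball (b := 0) (ε := ρ / 2) (by positivity)
        (closedBall_subset_ball (by linarith))
      rw [hN h, hψ0] at this
      refine (ball_subset_closedBall.trans (closedBall_subset_closedBall ?_)).trans this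
      push_cast
      linarith
  · set x := e.symm w with hx
    have hxs : x ∈ ball (0 : CSpace k) ρ := hes ▸ e.map_target hw
    have hdx : DifferentiableAt ℂ ψ x := hd.differentiableAt (isOpen_ball.mem_nhds (hsub1 hxs))
    have hnorm : ‖fderiv ℂ ψ x - ContinuousLinearMap.id ℂ (CSpace k)‖ ≤ 1 / 2 := by
      have h1 : fderiv ℂ (fun z => ψ z - z) x =
          fderiv ℂ ψ x - ContinuousLinearMap.id ℂ (CSpace k) := by
        rw [fderiv_fun_sub hdx differentiableAt_fun_id, fderiv_fun_id]
      rw [← h1]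
      refine norm_fderiv_le_of_lip' ℂ (by norm_num) ?_
      filter_upwards [isOpen_ball.mem_nhds hxs] with y hy using hlip x hxs y hy
    let u : (CSpace k →L[ℂ] CSpace k)ˣ :=
      Units.oneSub (ContinuousLinearMap.id ℂ (CSpace k) - fderiv ℂ ψ x) (by
        rw [norm_sub_rev]; linarith)
    have hu : (u : CSpace k →L[ℂ] CSpace k) = fderiv ℂ ψ x := by
      rw [Units.val_oneSub]
      exact sub_sub_cancel _ _
    let L : CSpace k ≃L[ℂ] CSpace k := ContinuousLinearEquiv.ofUnit u
    have hL : HasFDerivAt ψ (L : CSpace k →L[ℂ] CSpace k) x := by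
      have : (L : CSpace k →L[ℂ] CSpace k) = fderiv ℂ ψ x := by
        rw [← hu]; rfl
      rw [this]
      exact hdx.hasFDerivAt
    exact (e.hasFDerivAt_symm hw hL).differentiableAt

end NearIdentity

/-! ### Convergence of the conjugated compositions -/

section Convergence

variable {k : ℕ}

theorem Aut0.norm_compFirst_le {F : ℕ → Aut0 k} {b : ℝ} (hb0 : 0 ≤ b) (hb1 : b ≤ 1)
    (hF : ∀ n z, ‖z‖ < 1 → ‖(F n).toFun z‖ ≤ b * ‖z‖) (n : ℕ) {z : CSpace k} (hz : ‖z‖ < 1) :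
    ‖Aut0.compFirst F n z‖ ≤ b ^ n * ‖z‖ := by
  induction n with
  | zero => simp [Aut0.compFirst]
  | succ n ih =>
    rw [Aut0.compFirst_succ_apply]
    have h1 : b ^ n * ‖z‖ ≤ ‖z‖ := mul_le_of_le_one_left (norm_nonneg z) (pow_le_one₀ hb0 hb1)
    refine (hF n _ ((ih.trans h1).trans_lt hz)).trans ?_
    calc b * ‖Aut0.compFirst F n z‖ ≤ b * (b ^ n * ‖z‖) := by gcongr
      _ = _ := by ring

/-- The maps `G(n)⁻¹ ∘ X_n ∘ F(n)`, for the sequences shifted by `p`. -/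
noncomputable def conjugatedComp (F G : ℕ → Aut0 k) (X : ℕ → CSpace k → CSpace k) (p n : ℕ) (z : CSpace k) :
    CSpace k :=
  (Aut0.compFirst (fun i => G (p + i)) n).symm
    (X (p + n) (Aut0.compFirst (fun i => F (p + i)) n z))

/-- Transfers local convergence near the origin to points that `F(p)` brings close to it. -/
theorem conjugatedComp_add (F G : ℕ → Aut0 k) (X : ℕ → CSpace k → CSpace k) (p n : ℕ)
    (z : CSpace k) : (Aut0.compFirst G (p + n)).symm (X (p + n) (Aut0.compFirst F (p + n) z)) =
      (Aut0.compFirst G p).symm (conjugatedComp F G X p n (Aut0.compFirst F p z)) := by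
  rw [Aut0.compFirst_add, Aut0.compFirst_add]
  rfl

theorem differentiable_conjugatedComp (F G : ℕ → Aut0 k) {X : ℕ → CSpace k → CSpace k}
    (hX : ∀ n, Differentiable ℂ (X n)) (p n : ℕ) :
    Differentiable ℂ (conjugatedComp F G X p n) :=
  (Aut0.differentiable_compFirst_symm _ n).comp
    ((hX (p + n)).comp (Aut0.differentiable_compFirst _ n))

/-- Uniform local convergence of the conjugated compositions. -/
theorem exists_local_limit {F G : ℕ → Aut0 k} {X : ℕ → CSpace k → CSpace k} {b C K L : ℝ} {m : ℕ}
    (hb0 : 0 ≤ b) (hb1 : b < 1) (hC : 0 ≤ C) (hm : 2 ≤ m)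
    (hF : ∀ n z, ‖z‖ < 1 → ‖(F n).toFun z‖ ≤ b * ‖z‖)
    (hX : ∀ n z, ‖z‖ < 1 → ‖X n z - z‖ ≤ C * ‖z‖ ^ 2)
    (hdef : ∀ n z, ‖z‖ < 1 → ‖X (n + 1) ((F n).toFun z) - (G n).toFun (X n z)‖ ≤ C * ‖z‖ ^ m)
    (hK : 0 ≤ K) (hL : 0 ≤ L) (hKb : K * b ^ m < 1)
    (hG : ∀ n p u v, ‖u‖ ≤ 1 → ‖v‖ ≤ 1 →
      ‖(Aut0.compFirst (fun i => G (p + i)) n).symm u -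
        (Aut0.compFirst (fun i => G (p + i)) n).symm v‖ ≤ L * K ^ n * ‖u - v‖) :
    ∃ (ψ : ℕ → CSpace k → CSpace k) (r D : ℝ), 0 < r ∧ r ≤ 1 ∧ 0 ≤ D ∧
      (∀ p, TendstoUniformlyOn (conjugatedComp F G X p) (ψ p) atTop (ball 0 r)) ∧
      ∀ p, ∀ z ∈ ball (0 : CSpace k) r, ‖ψ p z - z‖ ≤ D * ‖z‖ ^ 2 := by
  -- With `(1 + C) * r = 1 / 2`, both points to which the inverse of the composition is applied lie
  -- in the unit ball, where its Lipschitz bound holds.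
  obtain ⟨r, hr⟩ : ∃ r : ℝ, r = (2 * (1 + C))⁻¹ := ⟨_, rfl⟩
  have hr0 : 0 < r := by rw [hr]; positivity
  have hrC : (1 + C) * r = 1 / 2 := by rw [hr]; field_simp
  have hr1 : r ≤ 1 := by nlinarith
  set q := K * b ^ m with hq
  have hq0 : 0 ≤ q := by positivity
  have hsmall : ∀ n (w : CSpace k), ‖w‖ < r → ‖X (n + 1) ((F n).toFun w)‖ ≤ 1 ∧
      ‖(G n).toFun (X n w)‖ ≤ 1 := by
    intro n w hw
    have hw0 := norm_nonneg w
    have hw1 : ‖w‖ < 1 := hw.trans_le hr1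
    have hCw : C * ‖w‖ ≤ 1 / 2 := by nlinarith
    have h1 : ‖(F n).toFun w‖ ≤ ‖w‖ := (hF n w hw1).trans (mul_le_of_le_one_left hw0 hb1.le)
    have h2 := hX (n + 1) _ (h1.trans_lt hw1)
    have h3 := norm_le_norm_add_norm_sub ((F n).toFun w) (X (n + 1) ((F n).toFun w))
    rw [norm_sub_rev] at h3
    have h4 : C * ‖(F n).toFun w‖ ^ 2 ≤ C * ‖w‖ := by
      refine mul_le_mul_of_nonneg_left ?_ hC
      nlinarith [norm_nonneg ((F n).toFun w)]
    have h5 : ‖X (n + 1) ((F n).toFun w)‖ ≤ 1 / 2 := by nlinarith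
    refine ⟨by linarith, ?_⟩
    have h6 := hdef n w hw1
    have h7 : C * ‖w‖ ^ m ≤ C * ‖w‖ :=
      mul_le_mul_of_nonneg_left (pow_le_of_le_one hw0 hw1.le (by omega)) hC
    have h8 := norm_le_norm_add_norm_sub (X (n + 1) ((F n).toFun w)) ((G n).toFun (X n w))
    linarith
  have hstep : ∀ p n, ∀ z ∈ ball (0 : CSpace k) r,
      dist (conjugatedComp F G X p n z) (conjugatedComp F G X p (n + 1) z) ≤
        L * K * C * ‖z‖ ^ m * q ^ n := by
    intro p n z hz
    have hz' : ‖z‖ < r := by simpa using hz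
    have hw := Aut0.norm_compFirst_le hb0 hb1.le (F := fun i => F (p + i)) (fun i => hF (p + i)) n
      (hz'.trans_le hr1)
    have e1 : conjugatedComp F G X p (n + 1) z =
        (Aut0.compFirst (fun i => G (p + i)) (n + 1)).symm
          (X (p + n + 1) ((F (p + n)).toFun (Aut0.compFirst (fun i => F (p + i)) n z))) := rfl
    -- Inserting `(G (p + n))⁻¹ ∘ G (p + n)` puts both terms under the same inverse, so their
    -- distance is controlled by the defect.
    have e2 : conjugatedComp F G X p n z =
        (Aut0.compFirst (fun i => G (p + i)) (n + 1)).symm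
          ((G (p + n)).toFun (X (p + n) (Aut0.compFirst (fun i => F (p + i)) n z))) := by
      rw [Aut0.compFirst_succ_symm_apply]
      exact congrArg (Aut0.compFirst (fun i => G (p + i)) n).symm ((G (p + n)).left_inv _).symm
    rw [e1, e2, dist_comm, dist_eq_norm]
    generalize Aut0.compFirst (fun i => F (p + i)) n z = w at hw ⊢
    have hwr : ‖w‖ < r := (hw.trans (mul_le_of_le_one_left (norm_nonneg z)
      (pow_le_one₀ hb0 hb1.le))).trans_lt hz'
    obtain ⟨h1, h2⟩ := hsmall (p + n) w hwr
    refine (hG (n + 1) p _ _ h1 h2).trans ?_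
    calc L * K ^ (n + 1) * _ ≤ L * K ^ (n + 1) * (C * (b ^ n * ‖z‖) ^ m) := by
          refine mul_le_mul_of_nonneg_left ((hdef _ w (hwr.trans_le hr1)).trans ?_) (by positivity)
          gcongr
      _ = _ := by rw [hq, mul_pow, mul_pow, ← pow_mul, ← pow_mul, mul_comm n m]; ring
  have hlim : ∀ p, ∀ z ∈ ball (0 : CSpace k) r,
      ∃ l, Tendsto (fun n => conjugatedComp F G X p n z) atTop (𝓝 l) := fun p z hz =>
    cauchySeq_tendsto_of_complete (cauchySeq_of_le_geometric q _ hKb fun n => hstep p n z hz)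
  choose! ψ hψ using hlim
  refine ⟨ψ, r, C + L * K * C / (1 - q), hr0, hr1, ?_, fun p => ?_, fun p z hz => ?_⟩
  · have : 0 < 1 - q := by linarith
    positivity
  · rw [Metric.tendstoUniformlyOn_iff]
    intro ε hε
    have h0 : Tendsto (fun n => L * K * C * q ^ n / (1 - q)) atTop (𝓝 (L * K * C * 0 / (1 - q))) :=
      ((tendsto_pow_atTop_nhds_zero_of_lt_one hq0 hKb).const_mul _).div_const _
    rw [mul_zero, zero_div] at h0
    filter_upwards [h0.eventually (gt_mem_nhds hε)] with n hn z hz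
    refine lt_of_le_of_lt ?_ hn
    rw [dist_comm]
    refine (dist_le_of_le_geometric_of_tendsto q _ hKb (fun n => hstep p n z hz)
      (hψ p z hz) n).trans ?_
    have : 0 < 1 - q := by linarith
    have hz1 : ‖z‖ ^ m ≤ 1 := pow_le_one₀ (norm_nonneg z)
      ((show ‖z‖ < r by simpa using hz).le.trans hr1)
    have : L * K * C * ‖z‖ ^ m ≤ L * K * C := mul_le_of_le_one_right (by positivity) hz1
    gcongr
  · have hz1 : ‖z‖ < 1 := (show ‖z‖ < r by simpa using hz).trans_le hr1
    have h1 := dist_le_of_le_geometric_of_tendsto₀ q _ hKb (fun n => hstep p n z hz) (hψ p z hz)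
    have h2 : conjugatedComp F G X p 0 z = X p z := rfl
    rw [h2, dist_comm, dist_eq_norm] at h1
    have h3 := hX p z hz1
    have h4 : ‖z‖ ^ m ≤ ‖z‖ ^ 2 := pow_le_pow_of_le_one (norm_nonneg z) hz1.le hm
    have h5 : 0 < 1 - q := by linarith
    calc ‖ψ p z - z‖ = ‖(ψ p z - X p z) + (X p z - z)‖ := by congr 1; abel
      _ ≤ L * K * C * ‖z‖ ^ m / (1 - q) + C * ‖z‖ ^ 2 :=
          (norm_add_le _ _).trans (add_le_add h1 h3)
      _ ≤ L * K * C * ‖z‖ ^ 2 / (1 - q) + C * ‖z‖ ^ 2 := by gcongr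
      _ = _ := by ring

/-- An orbit entering the unit ball contracts geometrically from then on. Thus the basin is a union
of preimages of one ball, hence open. -/
theorem Aut0.mem_basin_iff {F : ℕ → Aut0 k} {b r : ℝ} (hb0 : 0 ≤ b) (hb1 : b < 1) (hr0 : 0 < r)
    (hr1 : r ≤ 1) (hF : ∀ n z, ‖z‖ < 1 → ‖(F n).toFun z‖ ≤ b * ‖z‖) {z : CSpace k} :
    z ∈ Aut0.basin F ↔ ∃ p, Aut0.compFirst F p z ∈ ball (0 : CSpace k) r := by
  constructor
  · intro hz
    have hz' : Tendsto (fun n => Aut0.compFirst F n z) atTop (𝓝 0) := hz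
    exact (hz'.eventually (ball_mem_nhds 0 hr0)).exists
  · rintro ⟨p, hp⟩
    have hp1 : ‖Aut0.compFirst F p z‖ < 1 := (show _ < r by simpa using hp).trans_le hr1
    have h1 : Tendsto (fun n => Aut0.compFirst F (n + p) z) atTop (𝓝 0) := by
      have h2 : Tendsto (fun n => b ^ n * ‖Aut0.compFirst F p z‖) atTop (𝓝 0) := by
        simpa using (tendsto_pow_atTop_nhds_zero_of_lt_one hb0 hb1).mul_const
          ‖Aut0.compFirst F p z‖
      refine squeeze_zero_norm (fun n => ?_) h2
      rw [add_comm n p, Aut0.compFirst_add]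
      exact Aut0.norm_compFirst_le hb0 hb1.le (F := fun i => F (p + i)) (fun i => hF (p + i)) n hp1
    exact (tendsto_add_atTop_iff_nat p).1 h1

theorem Aut0.compFirst_mem_ball_of_le {F : ℕ → Aut0 k} {b r : ℝ} (hb0 : 0 ≤ b) (hb1 : b < 1)
    (hr1 : r ≤ 1) (hF : ∀ n z, ‖z‖ < 1 → ‖(F n).toFun z‖ ≤ b * ‖z‖) {z : CSpace k} {p n : ℕ}
    (hpn : p ≤ n) (hp : Aut0.compFirst F p z ∈ ball (0 : CSpace k) r) :
    Aut0.compFirst F n z ∈ ball (0 : CSpace k) r := by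
  obtain ⟨i, rfl⟩ := Nat.exists_eq_add_of_le hpn
  have hp' : ‖Aut0.compFirst F p z‖ < r := by simpa using hp
  rw [Aut0.compFirst_add, mem_ball_zero_iff]
  refine lt_of_le_of_lt (Aut0.norm_compFirst_le hb0 hb1.le (F := fun i => F (p + i))
    (fun i => hF (p + i)) i (hp'.trans_le hr1)) (lt_of_le_of_lt ?_ hp')
  exact mul_le_of_le_one_left (norm_nonneg _) (pow_le_one₀ hb0 hb1.le)

/-- Global convergence on the basin of attraction, to a biholomorphic map onto `ℂ^k`. -/
theorem exists_biholomorphic_limit {F G : ℕ → Aut0 k} {X ψ : ℕ → CSpace k → CSpace k}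
    {b r D : ℝ} (hb0 : 0 ≤ b) (hb1 : b < 1) (hr0 : 0 < r) (hr1 : r ≤ 1) (hD : 0 ≤ D)
    (hF : ∀ n z, ‖z‖ < 1 → ‖(F n).toFun z‖ ≤ b * ‖z‖) (hX : ∀ n, Differentiable ℂ (X n))
    (hG : ∀ w, Tendsto (fun n => Aut0.compFirst G n w) atTop (𝓝 0))
    (hconv : ∀ p, TendstoUniformlyOn (conjugatedComp F G X p) (ψ p) atTop (ball 0 r))
    (hψ : ∀ p, ∀ z ∈ ball (0 : CSpace k) r, ‖ψ p z - z‖ ≤ D * ‖z‖ ^ 2) :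
    ∃ Ψ : CSpace k → CSpace k,
      (∀ K : Set (CSpace k), IsCompact K → K ⊆ Aut0.basin F →
        TendstoUniformlyOn
          (fun n z => (Aut0.compFirst G n).symm (X n (Aut0.compFirst F n z))) Ψ atTop K) ∧
      IsBiholomorphicOnto Ψ (Aut0.basin F) Set.univ := by
  have hmem : ∀ z, z ∈ Aut0.basin F ↔ ∃ p, Aut0.compFirst F p z ∈ ball (0 : CSpace k) r :=
    fun z => Aut0.mem_basin_iff hb0 hb1 hr0 hr1 hF
  have hdψ : ∀ p, DifferentiableOn ℂ (ψ p) (ball 0 r) := fun p =>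
    differentiableOn_ball_of_tendstoUniformlyOn
      (fun n => (differentiable_conjugatedComp F G hX p n).differentiableOn) (hconv p)
  have hlim : ∀ p z, Aut0.compFirst F p z ∈ ball (0 : CSpace k) r →
      Tendsto (fun n => (Aut0.compFirst G n).symm (X n (Aut0.compFirst F n z))) atTop
        (𝓝 ((Aut0.compFirst G p).symm (ψ p (Aut0.compFirst F p z)))) := by
    intro p z hp
    rw [← tendsto_add_atTop_iff_nat p]
    have h1 := ((Aut0.differentiable_compFirst_symm G p).continuous.tendsto _).comp
      ((hconv p).tendsto_at hp)
    refine h1.congr fun n => ?_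
    rw [add_comm n p, conjugatedComp_add]
    rfl
  have hex : ∀ z ∈ Aut0.basin F, ∃ l,
      Tendsto (fun n => (Aut0.compFirst G n).symm (X n (Aut0.compFirst F n z))) atTop (𝓝 l) :=
    fun z hz => let ⟨p, hp⟩ := (hmem z).1 hz; ⟨_, hlim p z hp⟩
  choose! Ψ hΨlim using hex
  have hΨ : ∀ p z, Aut0.compFirst F p z ∈ ball (0 : CSpace k) r →
      Ψ z = (Aut0.compFirst G p).symm (ψ p (Aut0.compFirst F p z)) := fun p z hp =>
    tendsto_nhds_unique (hΨlim z ((hmem z).2 ⟨p, hp⟩)) (hlim p z hp)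
  have hopen : ∀ p, IsOpen {z | Aut0.compFirst F p z ∈ ball (0 : CSpace k) r} := fun p =>
    isOpen_ball.preimage (Aut0.differentiable_compFirst F p).continuous
  have hbasin : IsOpen (Aut0.basin F) := by
    have : Aut0.basin F = ⋃ p, {z | Aut0.compFirst F p z ∈ ball (0 : CSpace k) r} := by
      ext z; simp only [hmem z, Set.mem_iUnion, Set.mem_ofPred_eq]
    rw [this]
    exact isOpen_iUnion hopen
  refine ⟨Ψ, fun K hK hKb => ?_, hbasin, isOpen_univ, fun z hz => ?_, Set.mapsTo_univ _ _, ?_⟩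
  -- The preimages of the small ball increase with `p`, so a single `p` serves the whole compact
  -- set.
  · obtain ⟨p, hp⟩ := hK.elim_directed_cover
      (fun p => {z | Aut0.compFirst F p z ∈ ball (0 : CSpace k) r}) hopen
      (fun z hz => Set.mem_iUnion.2 ((hmem z).1 (hKb hz)))
      (directed_of_isDirected_le fun i j hij z hz =>
        Aut0.compFirst_mem_ball_of_le hb0 hb1 hr1 hF hij hz)
    have hR : ∀ z ∈ ball (0 : CSpace k) r, ‖ψ p z‖ ≤ 1 + D := fun z hz => by
      have hz1 : ‖z‖ ≤ 1 := (show ‖z‖ < r by simpa using hz).le.trans hr1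
      have h1 := hψ p z hz
      have h2 := norm_le_norm_add_norm_sub z (ψ p z)
      rw [norm_sub_rev] at h2
      have h3 : D * ‖z‖ ^ 2 ≤ D := mul_le_of_le_one_right hD (pow_le_one₀ (norm_nonneg z) hz1)
      linarith
    -- Since `‖ψ p z‖ ≤ 1 + D`, the radius `2 + D` also contains the approximants once they are
    -- within distance one.
    have huc : UniformContinuousOn (Aut0.compFirst G p).symm
        (closedBall (0 : CSpace k) (2 + D)) :=
      (isCompact_closedBall _ _).uniformContinuousOn_of_continuous
        (Aut0.differentiable_compFirst_symm G p).continuous.continuousOn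
    have h1 : TendstoUniformlyOn
        (fun n z => (Aut0.compFirst G p).symm (conjugatedComp F G X p n z))
        (fun z => (Aut0.compFirst G p).symm (ψ p z)) atTop (ball 0 r) := by
      refine huc.comp_tendstoUniformlyOn_eventually ?_ (fun z hz => ?_) (hconv p)
      · filter_upwards [Metric.tendstoUniformlyOn_iff.1 (hconv p) 1 one_pos] with n hn z hz
        have h2 := hn z hz
        rw [dist_eq_norm] at h2
        have h3 := norm_le_norm_add_norm_sub (ψ p z) (conjugatedComp F G X p n z)
        rw [mem_closedBall_zero_iff]
        linarith [hR z hz]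
      · rw [mem_closedBall_zero_iff]
        linarith [hR z hz]
    rw [Metric.tendstoUniformlyOn_iff] at h1 ⊢
    intro ε hε
    obtain ⟨N, hN⟩ := eventually_atTop.1 (h1 ε hε)
    refine eventually_atTop.2 ⟨p + N, fun n hn z hz => ?_⟩
    obtain ⟨i, rfl⟩ := Nat.exists_eq_add_of_le (show p ≤ n by omega)
    rw [hΨ p z (hp hz), conjugatedComp_add]
    exact hN i (by omega) _ (hp hz)
  · obtain ⟨p, hp⟩ := (hmem z).1 hz
    have h1 : DifferentiableAt ℂ
        (fun z => (Aut0.compFirst G p).symm (ψ p (Aut0.compFirst F p z))) z :=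
      (Aut0.differentiable_compFirst_symm G p _).comp z
        (((hdψ p).differentiableAt (isOpen_ball.mem_nhds hp)).comp z
          (Aut0.differentiable_compFirst F p z))
    refine (h1.congr_of_eventuallyEq ?_).differentiableWithinAt
    filter_upwards [(hopen p).mem_nhds hp] with y hy using hΨ p y hy
  -- Chosen to give `2 * ρ ≤ r` and `16 * D * ρ ≤ 1`; the radius does not depend on `p`, which both
  -- injectivity and surjectivity need.
  · obtain ⟨ρ, hρ⟩ : ∃ ρ : ℝ, ρ = r / (16 * (1 + D)) := ⟨_, rfl⟩
    have hρ0 : 0 < ρ := by rw [hρ]; positivity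
    have hρeq : 16 * ρ + 16 * D * ρ = r := by rw [hρ]; field_simp
    have hDρ : 0 ≤ D * ρ := by positivity
    have hloc : ∀ p, ∃ e : OpenPartialHomeomorph (CSpace k) (CSpace k), ⇑e = ψ p ∧
        e.source = ball 0 ρ ∧ ball 0 (ρ / 4) ⊆ e.target ∧
        ∀ w ∈ e.target, DifferentiableAt ℂ e.symm w := fun p =>
      exists_openPartialHomeomorph_of_near_id hD hρ0 (by linarith) (by linarith) (hdψ p) (hψ p)
    choose e hee hes het hed using hloc
    have hρr : ball (0 : CSpace k) ρ ⊆ ball 0 r := ball_subset_ball (by linarith)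
    have hinj : Set.InjOn Ψ (Aut0.basin F) := by
      intro z hz w hw hzw
      have hz' : Tendsto (fun n => Aut0.compFirst F n z) atTop (𝓝 0) := hz
      have hw' : Tendsto (fun n => Aut0.compFirst F n w) atTop (𝓝 0) := hw
      obtain ⟨p, hp1, hp2⟩ := ((hz'.eventually (ball_mem_nhds 0 hρ0)).and
        (hw'.eventually (ball_mem_nhds 0 hρ0))).exists
      rw [hΨ p z (hρr hp1), hΨ p w (hρr hp2)] at hzw
      have h1 := (Aut0.compFirst G p).symm.injective hzw
      rw [← hee p] at h1
      exact (Aut0.compFirst F p).injective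
        ((e p).injOn (by rw [hes]; exact hp1) (by rw [hes]; exact hp2) h1)
    have hsol : ∀ p w, Aut0.compFirst G p w ∈ ball (0 : CSpace k) (ρ / 4) →
        (Aut0.compFirst F p).symm ((e p).symm (Aut0.compFirst G p w)) ∈ Aut0.basin F ∧
        Ψ ((Aut0.compFirst F p).symm ((e p).symm (Aut0.compFirst G p w))) = w := by
      intro p w hw
      have h1 := (e p).map_target (het p hw)
      rw [hes] at h1
      have h2 : Aut0.compFirst F p ((Aut0.compFirst F p).symm
          ((e p).symm (Aut0.compFirst G p w))) ∈ ball (0 : CSpace k) r := by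
        rw [Equiv.apply_symm_apply]
        exact hρr h1
      refine ⟨(hmem _).2 ⟨p, h2⟩, ?_⟩
      rw [hΨ p _ h2, Equiv.apply_symm_apply, ← hee p, (e p).right_inv (het p hw),
        Equiv.symm_apply_apply]
    have hev : ∀ w, ∃ p, Aut0.compFirst G p w ∈ ball (0 : CSpace k) (ρ / 4) := fun w =>
      ((hG w).eventually (ball_mem_nhds 0 (by positivity))).exists
    have hsurj : Set.SurjOn Ψ (Aut0.basin F) Set.univ := fun w _ =>
      let ⟨p, hp⟩ := hev w
      ⟨_, (hsol p w hp).1, (hsol p w hp).2⟩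
    have hleft := hinj.leftInvOn_invFunOn
    refine ⟨Function.invFunOn Ψ (Aut0.basin F), fun w _ => ?_, hsurj.mapsTo_invFunOn,
      hleft, hsurj.rightInvOn_invFunOn⟩
    obtain ⟨p, hp⟩ := hev w
    have h1 : DifferentiableAt ℂ
        (fun w => (Aut0.compFirst F p).symm ((e p).symm (Aut0.compFirst G p w))) w :=
      (Aut0.differentiable_compFirst_symm F p _).comp w
        ((hed p _ (het p hp)).comp w (Aut0.differentiable_compFirst G p w))
    refine (h1.congr_of_eventuallyEq ?_).differentiableWithinAt
    have hop : IsOpen {w | Aut0.compFirst G p w ∈ ball (0 : CSpace k) (ρ / 4)} :=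
      isOpen_ball.preimage (Aut0.differentiable_compFirst G p).continuous
    filter_upwards [hop.mem_nhds hp] with v hv
    obtain ⟨h2, h3⟩ := hsol p v hv
    conv_lhs => rw [← h3]
    exact hleft h2

end Convergence

/-! ### Assembly of the main theorem -/

theorem mainTheorem2 (k : ℕ) (F : ℕ → Aut0 k)
    (hord : ∀ n, (F n).CorrectlyOrdered)
    (hattr : Aut0.UniformlyAttracting (Set.range F)) :
    ∃ (G : ℕ → Aut0 k) (P X : ℕ → PolyMap k) (Ψ : CSpace k → CSpace k),
      -- the maps `G_n` are lower triangular polynomial automorphisms with `G_n'(0) = F_n'(0)`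
      (∀ n, (G n).toFun = (P n).toMap ∧ (P n).IsLowerTriangular ∧
        fderiv ℂ (G n).toFun 0 = fderiv ℂ (F n).toFun 0) ∧
      PolyMap.BoundedSeq P ∧
      -- the maps `X_n` are polynomial maps with `X_n(0) = 0` and `X_n'(0) = id`
      (∀ n, (X n).toMap 0 = 0 ∧
        fderiv ℂ (X n).toMap 0 = ContinuousLinearMap.id ℂ (CSpace k)) ∧
      PolyMap.BoundedSeq X ∧
      -- `G(n)⁻¹ ∘ X_n ∘ F(n) → Ψ` uniformly on compact subsets of the basin
      (∀ K : Set (CSpace k), IsCompact K → K ⊆ Aut0.basin F →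
        TendstoUniformlyOn
          (fun n z => (Aut0.compFirst G n).symm ((X n).toMap (Aut0.compFirst F n z)))
          Ψ Filter.atTop K) ∧
      IsBiholomorphicOnto Ψ (Aut0.basin F) Set.univ := by
  obtain ⟨⟨a, b, ha0, hab, hb1, hFab⟩, ξ, hξ, hres⟩ := hattr
  have hb0 : 0 ≤ b := (ha0.trans hab).le
  have ha : ∀ n z, ‖z‖ < 1 → a * ‖z‖ ≤ ‖(F n).toFun z‖ := fun n z hz =>
    (hFab _ ⟨n, rfl⟩ z (by simpa using hz)).1
  have hb : ∀ n z, ‖z‖ < 1 → ‖(F n).toFun z‖ ≤ b * ‖z‖ := fun n z hz =>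
    (hFab _ ⟨n, rfl⟩ z (by simpa using hz)).2
  have hF : ∀ n, Differentiable ℂ (F n).toFun := fun n => (F n).differentiable_toFun
  have htri : ∀ n, ∀ i j : Fin k, i < j →
      fderiv ℂ (F n).toFun 0 (EuclideanSpace.single j 1) i = 0 := fun n => (hord n).1
  obtain ⟨P, hPtri, hPX⟩ := exists_triangular_normal_form (f := fun n => (F n).toFun) hF ha0 hb0
    hb1 hξ ha hb htri fun n i j l hlj => hres _ ⟨n, rfl⟩ i j l hlj
  -- The auxiliary `X₀` serves only to extract the bounds on `P`, which are needed before the final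
  -- order is known.
  obtain ⟨_, -, X₀, hX₀⟩ := hPX 0
  obtain ⟨C₀, hC₀, hest₀⟩ := hX₀.estimate
  obtain ⟨C₁, d, hC₁, hgrowth⟩ := hX₀.bounded_right.exists_norm_toMap_le
  have hPd : ∀ n, HasFDerivAt (P n).toMap (fderiv ℂ (F n).toFun 0) 0 := fun n =>
    hasFDerivAt_zero_of_norm_sub_le_sq fun z hz => (hest₀ n z hz).2.1
  have hP0 : ∀ n, (P n).toMap 0 = 0 := fun n => by
    simpa using (hest₀ n 0 (by simp)).2.1
  have hfam : TriangularFamily (fun n => (P n).toMap)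
      (fun n j => fderiv ℂ (F n).toFun 0 (EuclideanSpace.single j 1) j) a b C₁ d :=
    { differentiable := fun n => (P n).differentiable_toMap
      map_zero := hP0
      rem_congr := fun n j z w hzw => (hPtri n).toMap_sub_eq hzw
      pos := ha0
      lt_one := hb1
      le_diag := fun n j => le_norm_diag_of_lowerTriangular (htri n)
        (le_norm_fderiv_zero_apply (hF n) (ha n) (hb n)) j
      diag_le := fun n j => (CSpace.norm_apply_le _ _).trans
        (((fderiv ℂ (F n).toFun 0).le_opNorm _).trans
          (by simpa using norm_fderiv_zero_le hb0 (hb n)))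
      nonneg := hC₁
      growth := hgrowth }
  let G : ℕ → Aut0 k := hfam.toAut
  have hfamG : TriangularFamily (fun n => (G n).toFun)
      (fun n j => fderiv ℂ (F n).toFun 0 (EuclideanSpace.single j 1) j) a b C₁ d := hfam
  obtain ⟨K, hK, hGK⟩ := hfamG.exists_norm_compFirst_symm_sub_le
  have hK0 : 0 < K := by linarith
  -- The order of conjugation is chosen after `K`, to ensure `K * b ^ m < 1`; `G` does not change
  -- with it.
  obtain ⟨N, hN⟩ := exists_pow_lt_of_lt_one (inv_pos.2 hK0) hb1
  obtain ⟨m, hm, X, hX⟩ := hPX (max N 2)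
  obtain ⟨C, hC, hest⟩ := hX.estimate
  have hKb : K * b ^ m < 1 := by
    have h1 : b ^ m < K⁻¹ :=
      (pow_le_pow_of_le_one hb0 hb1.le ((le_max_left _ _).trans hm)).trans_lt hN
    calc K * b ^ m < K * K⁻¹ := by gcongr
      _ = 1 := mul_inv_cancel₀ hK0.ne'
  obtain ⟨ψ, r, D, hr0, hr1, hD, hconv, hψ⟩ := exists_local_limit (F := F) (G := G)
    (X := fun n => (X n).toMap) hb0 hb1 hC ((le_max_right _ _).trans hm) hb
    (fun n z hz => (hest n z hz).1) (fun n z hz => (hest n z hz).2.2) hK0.le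
    (Nat.cast_nonneg k) hKb hGK
  obtain ⟨Ψ, hΨ1, hΨ2⟩ := exists_biholomorphic_limit hb0 hb1 hr0 hr1 hD hb
    (fun n => (X n).differentiable_toMap) hfamG.tendsto_compFirst hconv hψ
  refine ⟨G, P, X, Ψ, fun n => ⟨rfl, (hPtri n).isLowerTriangular (hP0 n), (hPd n).fderiv⟩,
    hX₀.bounded_right, fun n => ⟨?_, ?_⟩, hX.bounded_left, hΨ1, hΨ2⟩
  · simpa using (hest n 0 (by simp)).1
  · exact (hasFDerivAt_zero_of_norm_sub_le_sq (A := ContinuousLinearMap.id ℂ (CSpace k))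
      fun z hz => (hest n z hz).1).fderiv
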